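/- **Theorem 1.** Let $D_L$ be a planar diagram of an oriented link $L$ with $n$ crossings, i.e. an oriented $4$-valent plane graph, every vertex of which is a positive or a negative crossing (so every connected component of the diagram contains a crossing). Let $J(L)\in\mathbb Z[q^{\pm1}]$ be the Jones polynomial, normalized by $$q^2J(L_+)-q^{-2}J(L_-)=(q-q^{-1})J(L_0),\qquad J(\text{unknot})=q+q^{-1}.$$ *Rotation numbers.* Isotope $D_L$ in the plane to a diagram $\widetilde D_L$ in which the two strands at every crossing are tangent to each other, pointing in the same direction. For an edge $e$, let $\mathrm{rot}(\tilde e)\in\mathbb R$ be the total rotation angle of the tangent along $e$ in $\widetilde D_L$, divided by $2\pi$, counter-clockwise rotation being positive. Let $\mathrm{rot}(L)=\sum_e\mathrm{rot}(\tilde e)$, which is the sum of the rotation numbers of the components of $\widetilde D_L$, and let $\omega(D_L)$ be the writhe, the sum of the signs $\pm1$ of the crossings. *The graph.* Look at each crossing with both strands pointing upwards, so that it has a left and a right incoming edge (from below) and a left and a right outgoing edge (above). Replace a positive crossing by the gadget with vertices $0,\dots,6$ and the weighted directed edges $$0\to1,\quad 0\to2,\quad 1\to2,\quad 2\to5,\quad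 3\to4,\quad 4\to5,\quad 5\to6,\quad 6\to3\qquad(\text{weight }1),$$ $$2\to3\ (a),\quad 1\to3\ (b),\quad 1\to0\ (c),\quad 2\to0\ (d),\quad 0\to5\ (e),$$ $$(a,b,c,d,e)=\Bigl(q-q^{-1},\ \tfrac{q+q^{-1}}2,\ -\tfrac q2,\ q,\ \tfrac12\Bigr).$$ The right incoming edge ends at $0$, the left incoming edge ends at $1$, the left outgoing edge starts at $4$ and the right outgoing edge starts at $6$. Replace a negative crossing by the mirror image (left and right exchanged) of this gadget, with $q$ and $q^{-1}$ exchanged in the weights. Each edge $e$ of $D_L$ then becomes a directed edge, of weight $q^{-2\,\mathrm{rot}(\tilde e)}$, between vertices of gadgets. Let $M_L$ be the weighted adjacency matrix of the resulting directed graph on $7n$ vertices. Then $$J(L)=q^{-2\omega(D_L)}\,q^{\mathrm{rot}(L)}\,\mathrm{per}(M_L),$$ as an identity of formal Laurent polynomials in $q$ with real exponents and rational coefficients. -/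

import Mathlib

open scoped LaurentPolynomial

/-! ### Oriented link diagrams -/

/-- Left or right, as seen when a crossing is looked at with both strands pointing upwards. -/
inductive Side
  | left
  | right
  deriving DecidableEq

instance : Fintype Side where
  elems := {.left, .right}
  complete x := by cases x <;> simp

/-- A pair (crossing, side). It names the incoming port (south-west for `left`, south-east for
`right`) of the crossing as well as its outgoing port (north-west for `left`, north-east for
`right`); the two strands run from south-west to north-east and from south-east to north-west. -/
abbrev Port (n : ℕ) := Fin n × Side

/-- The half-edges of an oriented 4-valent graph whose `n` vertices are crossings. -/
inductive HalfEdge (n : ℕ)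
  | outgoing (p : Port n)
  | incoming (p : Port n)
  deriving DecidableEq, Fintype

section CombinatorialMap

variable {n : ℕ}

/-- If the edge leaving through the outgoing port `p` ends at the incoming port `next p`, this is
the involution that exchanges the two halves of every edge. -/
def edgeFlip (next : Equiv.Perm (Port n)) : Equiv.Perm (HalfEdge n) where
  toFun
    | .outgoing p => .incoming (next p)
    | .incoming p => .outgoing (next.symm p)
  invFun
    | .outgoing p => .incoming (next p)
    | .incoming p => .outgoing (next.symm p)
  left_inv h := by cases h <;> simp
  right_inv h := by cases h <;> simp

/-- The clockwise rotation of the four half-edges around each crossing: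
south-west, north-west, north-east, south-east. -/
def clockwise : Equiv.Perm (HalfEdge n) where
  toFun
    | .incoming (v, .left) => .outgoing (v, .left)
    | .outgoing (v, .left) => .outgoing (v, .right)
    | .outgoing (v, .right) => .incoming (v, .right)
    | .incoming (v, .right) => .incoming (v, .left)
  invFun
    | .outgoing (v, .left) => .incoming (v, .left)
    | .outgoing (v, .right) => .outgoing (v, .left)
    | .incoming (v, .right) => .outgoing (v, .right)
    | .incoming (v, .left) => .incoming (v, .right)
  left_inv h := by rcases h with ⟨v, _ | _⟩ | ⟨v, _ | _⟩ <;> rfl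
  right_inv h := by rcases h with ⟨v, _ | _⟩ | ⟨v, _ | _⟩ <;> rfl

/-- The face permutation. A half-edge `h` stands for the walk along its edge that starts at `h`
and has a face on its left; the walk arrives at `edgeFlip next h`, and the walk along the boundary
of that face goes on with the next half-edge in clockwise order. -/
def facePerm (next : Equiv.Perm (Port n)) : Equiv.Perm (HalfEdge n) :=
  (edgeFlip next).trans clockwise

/-- The number of faces: cycles (fixed points included) of the face permutation. -/
noncomputable def faceCount (next : Equiv.Perm (Port n)) : ℕ :=
  Nat.card (Quotient (Equiv.Perm.SameCycle.setoid (facePerm next)))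

/-- The graph on the crossings in which the ends of every edge are adjacent. -/
def crossingGraph (next : Equiv.Perm (Port n)) : SimpleGraph (Fin n) :=
  SimpleGraph.fromRel fun v w => ∃ s t, next (v, s) = (w, t)

/-- The number of connected components of the 4-valent graph. -/
noncomputable def componentCount (next : Equiv.Perm (Port n)) : ℕ :=
  Nat.card (crossingGraph next).ConnectedComponent

end CombinatorialMap

/-- The sign of a crossing. -/
inductive CrossingSign
  | positive
  | negative
  deriving DecidableEq

instance : Fintype CrossingSign where
  elems := {.positive, .negative}
  complete x := by cases x <;> simp

/-- A planar diagram, with `n` crossings, of an oriented link: an oriented 4-valent plane graph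
(given by its combinatorial map) each of whose vertices is a positive or a negative crossing. -/
structure LinkDiagram (n : ℕ) where
  /-- the edge that leaves through the outgoing port `p` ends at the incoming port `next p` -/
  next : Equiv.Perm (Port n)
  /-- the type of each crossing -/
  sign : Fin n → CrossingSign
  /-- Euler's formula `V - E + F = 2` for every connected component (here `E = 2V`; as no
  component can exceed `V - E + F = 2`, the sum over the components says this for each) -/
  planar : faceCount next = n + 2 * componentCount next

/-- The writhe: the sum of the signs of the crossings. -/
def LinkDiagram.writhe {n : ℕ} (D : LinkDiagram n) : ℤ :=
  ∑ v, match D.sign v with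
    | .positive => 1
    | .negative => -1

/-! ### The Jones polynomial -/

/-- The two ways to smooth a crossing: `oriented` joins each incoming port to the outgoing port on
the same side; `disoriented` joins the two incoming ports, and the two outgoing ports. -/
inductive Smoothing
  | oriented
  | disoriented
  deriving DecidableEq

instance : Fintype Smoothing where
  elems := {.oriented, .disoriented}
  complete x := by cases x <;> simp

section Bracket

variable {n : ℕ}

/-- Two edges (named by their outgoing ports) are joined at some crossing by the smoothing `s`. -/
def JoinedBySmoothing (next : Equiv.Perm (Port n)) (s : Fin n → Smoothing) (e f : Port n) : Prop :=
  ∃ v, match s v with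
    | .oriented => ∃ t, next e = (v, t) ∧ f = (v, t)
    | .disoriented =>
      (next e = (v, .left) ∧ next f = (v, .right)) ∨ (e = (v, .left) ∧ f = (v, .right))

/-- The number of closed curves that are left when all crossings are smoothed. -/
noncomputable def loopCount (next : Equiv.Perm (Port n)) (s : Fin n → Smoothing) : ℕ :=
  Nat.card (Quot (JoinedBySmoothing next s))

/-- The Kauffman state sum with local coefficients `w`: every crossing `v` is expanded as
`w v oriented • (oriented smoothing) + w v disoriented • (disoriented smoothing)`, and every closed
curve counts `q + q⁻¹`. -/
noncomputable def kauffmanSum (next : Equiv.Perm (Port n)) (w : Fin n → Smoothing → ℚ[T;T⁻¹]) :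
    ℚ[T;T⁻¹] :=
  ∑ s : Fin n → Smoothing,
    (∏ v, w v (s v)) * (LaurentPolynomial.T 1 + LaurentPolynomial.T (-1)) ^ loopCount next s

/-- The coefficients of the Kauffman bracket together with the writhe normalization.
Up to the normalization, a positive crossing is `oriented - q⁻¹ disoriented` and a negative
crossing is `disoriented - q⁻¹ oriented`; the normalization multiplies by `q⁻¹` for every positive
crossing, and by `-q²` for every negative one. -/
noncomputable def jonesCoeff : CrossingSign → Smoothing → ℚ[T;T⁻¹]
  | .positive, .oriented => LaurentPolynomial.T (-1)
  | .positive, .disoriented => -LaurentPolynomial.T (-2)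
  | .negative, .oriented => LaurentPolynomial.T 1
  | .negative, .disoriented => -LaurentPolynomial.T 2

/-- The Jones polynomial, a Laurent polynomial in `q` (written `T`), of the link with the given
diagram, through Kauffman's bracket, in the normalization `J(unknot) = q + q⁻¹` and
`q² J(L₊) - q⁻² J(L₋) = (q - q⁻¹) J(L₀)`. -/
noncomputable def LinkDiagram.jones (D : LinkDiagram n) : ℚ[T;T⁻¹] :=
  kauffmanSum D.next fun v => jonesCoeff (D.sign v)

/-- The skein relation that fixes the normalization of `LinkDiagram.jones`. The three state sums
are those of three links that differ only at `v`, where they have a positive crossing, a negative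
crossing, and the oriented smoothing. -/
theorem kauffmanSum_skein (next : Equiv.Perm (Port n)) (w : Fin n → Smoothing → ℚ[T;T⁻¹])
    (v : Fin n) :
    LaurentPolynomial.T 2 * kauffmanSum next (Function.update w v (jonesCoeff .positive)) -
        LaurentPolynomial.T (-2) * kauffmanSum next (Function.update w v (jonesCoeff .negative)) =
      (LaurentPolynomial.T 1 - LaurentPolynomial.T (-1)) *
        kauffmanSum next
          (Function.update w v (fun s => if s = .oriented then 1 else 0)) := by
  have key : ∀ (c : Smoothing → ℚ[T;T⁻¹]) (s : Fin n → Smoothing),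
      ∏ u, Function.update w v c u (s u) =
        c (s v) * ∏ u ∈ Finset.univ.erase v, w u (s u) := by
    intro c s
    rw [← Finset.mul_prod_erase _ _ (Finset.mem_univ v), Function.update_self]
    congr 1
    refine Finset.prod_congr rfl fun u hu => ?_
    rw [Function.update_of_ne (Finset.ne_of_mem_erase hu)]
  have loc : ∀ s : Smoothing,
      LaurentPolynomial.T 2 * jonesCoeff .positive s -
        LaurentPolynomial.T (-2) * jonesCoeff .negative s =
      (LaurentPolynomial.T 1 - LaurentPolynomial.T (-1)) * (if s = .oriented then 1 else 0) := by
    intro s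
    cases s
    · simp only [jonesCoeff, ← LaurentPolynomial.T_add, if_true, mul_one]
      norm_num
    · rw [if_neg Smoothing.noConfusion]
      simp only [jonesCoeff, mul_neg, mul_zero, ← LaurentPolynomial.T_add]
      norm_num
  unfold kauffmanSum
  simp only [key, Finset.mul_sum, ← Finset.sum_sub_distrib]
  refine Finset.sum_congr rfl fun s _ => ?_
  linear_combination (∏ u ∈ Finset.univ.erase v, w u (s u)) *
    (LaurentPolynomial.T 1 + LaurentPolynomial.T (-1)) ^ loopCount next s * loc (s v)

end Bracket

/-! ### Rotation numbers -/

/-- The turning, in full turns, at the corner that a walk with a face on its left passes after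
it has arrived at a crossing along the half-edge `h`, when the two strands of the crossing are
tangent to each other there, pointing upwards: on the left and on the right of the crossing the
walk goes straight on, and at the bottom and at the top it meets a cusp and makes a half turn to
the left. -/
noncomputable def cornerTurn {n : ℕ} : HalfEdge n → ℝ
  | .incoming (_, .left) => 0
  | .incoming (_, .right) => 1 / 2
  | .outgoing (_, .left) => 1 / 2
  | .outgoing (_, .right) => 0

/-- The rotation number of the walk along an edge that starts at a given half-edge, when `r e` is
the rotation number of the edge leaving through the outgoing port `e`, along its orientation. -/
def edgeTurn {n : ℕ} (next : Equiv.Perm (Port n)) (r : Port n → ℝ) : HalfEdge n → ℝ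
  | .outgoing p => r p
  | .incoming p => -r (next.symm p)

open Classical in
/-- The total rotation of the tangent, in full turns, along the boundary of the face on the left
of the half-edge `h`. -/
noncomputable def faceTurn {n : ℕ} (next : Equiv.Perm (Port n)) (r : Port n → ℝ)
    (h : HalfEdge n) : ℝ :=
  ∑ k : HalfEdge n with (facePerm next).SameCycle h k,
    (edgeTurn next r k + cornerTurn (edgeFlip next k))

/-- A drawing of the diagram in the oriented plane, up to isotopy, in which the two strands at each
crossing are tangent to each other (in any direction). It is recorded, as usual for drawings of
plane graphs, by its angles: `rot e` is the rotation number of the edge `e`, that is, the total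
rotation angle of its tangent divided by `2π`, counter-clockwise rotation being positive. That
these are the angles of a plane drawing means that the boundary of every face, with the face on the
left, makes one full turn: `+1` if the face is bounded, and `-1` if it is the unbounded face (of a
connected component; by Euler's formula, each component then has exactly one unbounded face). -/
structure LinkDiagram.TangentialDrawing {n : ℕ} (D : LinkDiagram n) where
  /-- the rotation number of the edge that leaves through a given outgoing port -/
  rot : Port n → ℝ
  /-- every face boundary makes one full turn -/
  faceTurn_eq : ∀ h, faceTurn D.next rot h = 1 ∨ faceTurn D.next rot h = -1

/-- The rotation number of the link diagram: the total rotation of the tangents of all its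
components, that is, of all its edges (at the crossings the tangents agree). -/
noncomputable def LinkDiagram.TangentialDrawing.linkRot {n : ℕ} {D : LinkDiagram n}
    (R : D.TangentialDrawing) : ℝ :=
  ∑ e, R.rot e

/-! ### The matrix -/

/-- Laurent polynomials in `q` with rational coefficients and arbitrary real exponents. -/
abbrev RealLaurent := AddMonoidAlgebra ℚ ℝ

/-- The power `q ^ x`, for a real exponent `x`. -/
noncomputable def qpow (x : ℝ) : RealLaurent := AddMonoidAlgebra.single x 1

/-- The inclusion of the Laurent polynomials in `q`. -/
noncomputable def toRealLaurent : ℚ[T;T⁻¹] →+* RealLaurent :=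
  AddMonoidAlgebra.mapDomainRingHom ℚ (Int.castAddHom ℝ)

/-- The weighted directed edges inside the gadget, on the vertices `0, …, 6`; absent edges have
weight `0`. -/
def gadget {R : Type*} [CommRing R] (a b c d e : R) : Matrix (Fin 7) (Fin 7) R :=
  !![0, 1, 1, 0, 0, e, 0;
     c, 0, 1, b, 0, 0, 0;
     d, 0, 0, a, 0, 1, 0;
     0, 0, 0, 0, 1, 0, 0;
     0, 0, 0, 0, 0, 1, 0;
     0, 0, 0, 0, 0, 0, 1;
     0, 0, 0, 1, 0, 0, 0]

/-- The gadget with the weights of a positive and of a negative crossing, respectively. -/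
noncomputable def crossingGadget : CrossingSign → Matrix (Fin 7) (Fin 7) RealLaurent
  | .positive => gadget (qpow 1 - qpow (-1)) ((1 / 2 : ℚ) • (qpow 1 + qpow (-1)))
      ((-1 / 2 : ℚ) • qpow 1) (qpow 1) ((1 / 2 : ℚ) • 1)
  | .negative => gadget (qpow (-1) - qpow 1) ((1 / 2 : ℚ) • (qpow 1 + qpow (-1)))
      ((-1 / 2 : ℚ) • qpow (-1)) (qpow (-1)) ((1 / 2 : ℚ) • 1)

/-- The vertex of the gadget at which the edge coming into a given side of the crossing ends.
The gadget of a negative crossing is the mirror image of that of a positive one. -/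
def entryVertex : CrossingSign → Side → Fin 7
  | .positive, .right => 0
  | .positive, .left => 1
  | .negative, .left => 0
  | .negative, .right => 1

/-- The vertex of the gadget at which the edge going out of a given side of the crossing starts. -/
def exitVertex : CrossingSign → Side → Fin 7
  | .positive, .left => 4
  | .positive, .right => 6
  | .negative, .right => 4
  | .negative, .left => 6

open Classical in
/-- The weighted adjacency matrix of the blown-up diagram: the gadget of every crossing and, for
every edge `e` of the diagram, an edge of weight `q ^ (-2 rot e)` from the exit vertex at which
`e` starts to the entry vertex at which it ends. -/
noncomputable def LinkDiagram.TangentialDrawing.adjacency {n : ℕ} {D : LinkDiagram n}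
    (R : D.TangentialDrawing) : Matrix (Fin n × Fin 7) (Fin n × Fin 7) RealLaurent :=
  fun x y =>
    (if x.1 = y.1 then crossingGadget (D.sign x.1) x.2 y.2 else 0) +
      ∑ e : Port n,
        if x = (e.1, exitVertex (D.sign e.1) e.2) ∧
            y = ((D.next e).1, entryVertex (D.sign (D.next e).1) (D.next e).2) then
          qpow (-2 * R.rot e)
        else 0

/-! Both sides are sums over sets `ε : Port n → Bool` of edges, and the summands agree crossing by
crossing, up to a sign that planarity removes.

Jones side: a smoothed diagram consists of disjoint simple closed plane curves. Each has turning
number 1 in one direction and -1 in the other, so its value q + q⁻¹ is the sum of q^(turning number)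
over its two directions. Directing all loops amounts to choosing the set `ε` of edges that are run
backwards, and the turning number is a sum of ±rot over edges and of half turns at the disoriented
smoothings (`sum_smoothingWeight`). For fixed `ε` the sum over smoothings factors over the
crossings.

Permanent side: Ryser's formula factors over the crossings once the set `ε` of used diagram edges is
fixed (`permanent_adjacency`), and q^rot(L) turns the edge factors q^(-2 rot) or 1 into q^(∓rot).
The gadget realizes the entries of an R-matrix: for a positive crossing q, q, 1, 1, q - q⁻¹ and 0.
For balanced usage these are the Jones weights up to (-1) to the number of used right ports
(`crossingWeight_expand`). If some crossing is unbalanced, then some crossing has fewer used edges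
coming in than going out, and both products vanish (`prod_crossingWeight`). Balanced usage is a
cycle mod 2, and a checkerboard colouring shows that its signs multiply to 1 (`prod_usageSign`).

The topology is combinatorial and rests on `genus_nonneg`. Smoothing a crossing cuts a vertex of the
map in two; `PlanarTurning.mul_swap` shows that the faces keep turning numbers ±1, with one -1 in
every component, so that after all smoothings each loop turns by ±1. The colouring exists because
the double cover that obstructs it has so many faces that, its genus being nonnegative, it must be
trivial. -/

/-! ### Counting the classes of an equivalence relation -/

section ClassCount

variable {H : Type*}

open Classical in
/-- The number of classes of `r` that meet `S`. -/
noncomputable def classCount (r : Setoid H) (S : Finset H) : ℕ :=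
  (S.image (Quotient.mk r)).card

/-- `S` is a union of classes of `r`. -/
def Saturated (r : Setoid H) (S : Finset H) : Prop :=
  ∀ x y, r x y → x ∈ S → y ∈ S

theorem Saturated.mono {r t : Setoid H} {S : Finset H} (h : r ≤ t) (hS : Saturated t S) :
    Saturated r S := fun x y hxy => hS x y (h hxy)

theorem Saturated.sdiff [DecidableEq H] {r : Setoid H} {S T : Finset H} (hS : Saturated r S)
    (hT : Saturated r T) : Saturated r (S \ T) := by
  intro x y hxy hx
  rw [Finset.mem_sdiff] at hx ⊢
  exact ⟨hS x y hxy hx.1, fun hy => hx.2 (hT y x (r.symm hxy) hy)⟩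

theorem Saturated.inter [DecidableEq H] {r : Setoid H} {S T : Finset H} (hS : Saturated r S)
    (hT : Saturated r T) : Saturated r (S ∩ T) := by
  intro x y hxy hx
  rw [Finset.mem_inter] at hx ⊢
  exact ⟨hS x y hxy hx.1, hT x y hxy hx.2⟩

theorem saturated_univ [Fintype H] (r : Setoid H) : Saturated r Finset.univ :=
  fun _ _ _ _ => Finset.mem_univ _

open Classical in
/-- The class of `a`, as a finset. -/
noncomputable def classOf [Fintype H] (r : Setoid H) (a : H) : Finset H :=
  Finset.univ.filter (r a ·)

theorem mem_classOf [Fintype H] {r : Setoid H} {a x : H} : x ∈ classOf r a ↔ r a x := by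
  simp [classOf]

theorem self_mem_classOf [Fintype H] (r : Setoid H) (a : H) : a ∈ classOf r a :=
  mem_classOf.2 (r.refl a)

theorem saturated_classOf [Fintype H] (r : Setoid H) (a : H) : Saturated r (classOf r a) :=
  fun _ _ hxy hx => mem_classOf.2 (r.trans (mem_classOf.1 hx) hxy)

theorem Finset.card_image_le_card_image {K L : Type*} {_ : DecidableEq K} {_ : DecidableEq L} {S : Finset H} {f : H → K} {g : H → L}
    (h : ∀ x ∈ S, ∀ y ∈ S, g x = g y → f x = f y) : (S.image f).card ≤ (S.image g).card := by
  classical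
  rcases S.eq_empty_or_nonempty with rfl | ⟨x₀, -⟩
  · simp
  let k : L → K := fun b => if hb : ∃ x ∈ S, g x = b then f hb.choose else f x₀
  have : S.image f = (S.image g).image k := by
    rw [Finset.image_image]
    refine Finset.image_congr fun x hx => ?_
    have hb : ∃ y ∈ S, g y = g x := ⟨x, hx, rfl⟩
    simp only [Function.comp_apply, k, dif_pos hb]
    exact h x hx _ hb.choose_spec.1 hb.choose_spec.2.symm
  rw [this]
  exact Finset.card_image_le

theorem Finset.card_image_eq_card_image {K L : Type*} {_ : DecidableEq K} {_ : DecidableEq L} {S : Finset H} {f : H → K} {g : H → L}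
    (h : ∀ x ∈ S, ∀ y ∈ S, f x = f y ↔ g x = g y) : (S.image f).card = (S.image g).card :=
  le_antisymm (Finset.card_image_le_card_image fun x hx y hy => (h x hx y hy).2)
    (Finset.card_image_le_card_image fun x hx y hy => (h x hx y hy).1)

theorem classCount_ker {K : Type*} [DecidableEq K] (f : H → K) (S : Finset H) :
    classCount (Setoid.ker f) S = (S.image f).card := by
  unfold classCount
  refine Finset.card_image_eq_card_image fun x _ y _ => ?_
  exact Quotient.eq

theorem classCount_congr {r t : Setoid H} {S : Finset H}
    (h : ∀ x ∈ S, ∀ y ∈ S, r x y ↔ t x y) : classCount r S = classCount t S := by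
  unfold classCount
  refine Finset.card_image_eq_card_image fun x hx y hy => ?_
  exact Quotient.eq.trans ((h x hx y hy).trans Quotient.eq.symm)

theorem classCount_anti {r t : Setoid H} (h : r ≤ t) (S : Finset H) :
    classCount t S ≤ classCount r S := by
  unfold classCount
  refine Finset.card_image_le_card_image fun x _ y _ hxy => ?_
  exact Quotient.eq.2 (h (Quotient.eq.1 hxy))

theorem classCount_union [DecidableEq H] {r : Setoid H} {S T : Finset H} (hS : Saturated r S)
    (hST : Disjoint S T) : classCount r (S ∪ T) = classCount r S + classCount r T := by
  classical
  unfold classCount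
  rw [Finset.image_union, Finset.card_union_of_disjoint]
  rw [Finset.disjoint_left]
  intro q hq hq'
  obtain ⟨x, hx, rfl⟩ := Finset.mem_image.1 hq
  obtain ⟨y, hy, hxy⟩ := Finset.mem_image.1 hq'
  rw [Quotient.eq] at hxy
  exact Finset.disjoint_left.1 hST (hS x y (r.symm hxy) hx) hy

theorem classCount_sdiff_add [DecidableEq H] {r : Setoid H} {S T : Finset H} (hT : Saturated r T)
    (hTS : T ⊆ S) : classCount r (S \ T) + classCount r T = classCount r S := by
  conv_rhs => rw [← Finset.union_sdiff_of_subset hTS]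
  rw [classCount_union hT Finset.disjoint_sdiff, add_comm]

theorem classCount_univ [Fintype H] (r : Setoid H) :
    classCount r Finset.univ = Nat.card (Quotient r) := by
  classical
  unfold classCount
  rw [Nat.card_eq_fintype_card, Finset.image_univ_of_surjective Quotient.mk_surjective,
    Finset.card_univ]

theorem classCount_classOf [Fintype H] (r : Setoid H) (a : H) :
    classCount r (classOf r a) = 1 := by
  classical
  unfold classCount
  rw [Finset.card_eq_one]
  refine ⟨Quotient.mk r a, ?_⟩
  ext q
  rw [Finset.mem_image, Finset.mem_singleton]
  constructor
  · rintro ⟨x, hx, rfl⟩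
    exact Quotient.sound (r.symm (mem_classOf.1 hx))
  · rintro rfl
    exact ⟨a, self_mem_classOf r a, rfl⟩

theorem classCount_of_forall_eq {r : Setoid H} {S : Finset H}
    (h : ∀ x ∈ S, ∀ y ∈ S, r x y → x = y) : classCount r S = S.card := by
  classical
  unfold classCount
  exact Finset.card_image_of_injOn fun x hx y hy hxy => h x hx y hy (Quotient.eq.1 hxy)

open Classical in
/-- The equivalence relation obtained from `r` by merging the classes of `a` and `b`. -/
noncomputable def glue (r : Setoid H) (a b : H) : Setoid H :=
  Setoid.ker fun x => if r x b then (Quotient.mk r a) else Quotient.mk r x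

theorem le_glue (r : Setoid H) (a b : H) : r ≤ glue r a b := by
  intro x y hxy
  rw [glue, Setoid.ker_def]
  by_cases hx : r x b
  · rw [if_pos hx, if_pos (r.trans (r.symm hxy) hx)]
  · rw [if_neg hx, if_neg fun hy => hx (r.trans hxy hy)]
    exact Quotient.sound hxy

theorem glue_rel (r : Setoid H) (a b : H) : glue r a b a b := by
  rw [glue, Setoid.ker_def, if_pos (r.refl b)]
  split_ifs <;> rfl

theorem glue_le_iff {r t : Setoid H} {a b : H} : glue r a b ≤ t ↔ r ≤ t ∧ t a b := by
  refine ⟨fun h => ⟨(le_glue r a b).trans h, h (glue_rel r a b)⟩, fun ⟨h, hab⟩ x y hxy => ?_⟩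
  rw [glue, Setoid.ker_def] at hxy
  split_ifs at hxy with hx hy hy
  · exact h (r.trans hx (r.symm hy))
  · exact t.trans (h hx) (t.trans (t.symm hab) (h (Quotient.eq.1 hxy)))
  · exact t.trans (h (Quotient.eq.1 hxy)) (t.trans hab (h (r.symm hy)))
  · exact h (Quotient.eq.1 hxy)

theorem glue_eq_self {r : Setoid H} {a b : H} (h : r a b) : glue r a b = r :=
  le_antisymm (glue_le_iff.2 ⟨le_rfl, h⟩) (le_glue r a b)

theorem glue_sup (r t : Setoid H) (a b : H) : glue r a b ⊔ t = glue (r ⊔ t) a b := by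
  apply le_antisymm
  · refine sup_le (glue_le_iff.2 ⟨le_sup_left.trans (le_glue _ a b), glue_rel _ a b⟩)
      (le_sup_right.trans (le_glue _ a b))
  · exact glue_le_iff.2 ⟨sup_le_sup_right (le_glue r a b) t,
      (le_sup_left : glue r a b ≤ glue r a b ⊔ t) (glue_rel r a b)⟩

theorem classCount_glue {r : Setoid H} {a b : H} {S : Finset H} (hab : ¬ r a b) (ha : a ∈ S)
    (hb : b ∈ S) : classCount (glue r a b) S + 1 = classCount r S := by
  classical
  rw [glue, classCount_ker]
  -- Merging redirects the class of `b` to that of `a`, so exactly one class disappears from the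
  -- image.
  have : S.image (fun x => if r x b then (Quotient.mk r a) else Quotient.mk r x) =
      (S.image (Quotient.mk r)).erase (Quotient.mk r b) := by
    ext q
    simp only [Finset.mem_image, Finset.mem_erase]
    constructor
    · rintro ⟨x, hx, rfl⟩
      split_ifs with h
      · exact ⟨fun h' => hab (Quotient.eq.1 h'), a, ha, rfl⟩
      · exact ⟨fun h' => h (Quotient.eq.1 h'), x, hx, rfl⟩
    · rintro ⟨hq, x, hx, rfl⟩
      exact ⟨x, hx, if_neg fun h => hq (Quotient.sound h)⟩
  convert Finset.card_erase_add_one (Finset.mem_image_of_mem (Quotient.mk r) hb) using 2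
  rw [← this]
  congr!

theorem classCount_glue_of_notMem {r : Setoid H} {a b : H} {S : Finset H} (hS : Saturated r S)
    (hb : b ∉ S) : classCount (glue r a b) S = classCount r S := by
  classical
  unfold glue
  rw [classCount_ker]
  unfold classCount
  refine Finset.card_image_eq_card_image fun x hx y hy => ?_
  rw [if_neg fun h => hb (hS x b h hx), if_neg fun h => hb (hS y b h hy)]

theorem classCount_le_glue_add_one (r : Setoid H) (a b : H) {S : Finset H} (ha : a ∈ S)
    (hb : b ∈ S) : classCount r S ≤ classCount (glue r a b) S + 1 := by
  by_cases h : r a b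
  · rw [glue_eq_self h]; omega
  · exact (classCount_glue h ha hb).ge

end ClassCount

/-! ### Cycles of permutations -/

section Cycles

open Equiv Perm

variable {H : Type*}

theorem cycles_le_iff {π : Perm H} {t : Setoid H} :
    SameCycle.setoid π ≤ t ↔ ∀ x, t x (π x) := by
  refine ⟨fun h x => h (sameCycle_apply_right.2 (SameCycle.refl π x)), fun h => ?_⟩
  have key : ∀ (k : ℕ) (x : H), t x ((π ^ k) x) := by
    intro k
    induction k with
    | zero => exact fun x => t.refl x
    | succ k ih =>
      intro x
      rw [pow_succ']
      exact t.trans (ih x) (h _)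
  rintro x y ⟨i, rfl⟩
  cases i with
  | ofNat k => exact key k x
  | negSucc k =>
    have := key (k + 1) ((π ^ (Int.negSucc k)) x)
    rw [← mul_apply, ← zpow_natCast, ← zpow_add] at this
    simp only [Int.negSucc_eq, Nat.cast_add, Nat.cast_one, add_neg_cancel, zpow_zero,
      one_apply] at this
    exact t.symm this

theorem saturated_cycles_iff [Finite H] {π : Perm H} {S : Finset H} :
    Saturated (SameCycle.setoid π) S ↔ ∀ x ∈ S, π x ∈ S := by
  refine ⟨fun h x hx => h x _ (sameCycle_apply_right.2 (SameCycle.refl π x)) hx, fun h x y hxy hx => ?_⟩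
  obtain ⟨i, rfl⟩ := SameCycle.exists_nat_pow_eq hxy
  clear hxy
  induction i with
  | zero => exact hx
  | succ k ih => rw [pow_succ']; exact h _ ih

variable [DecidableEq H]

/-- Until the orbit of `a` first returns to `a` or `b`, the transposition does not interfere with
it; whether it returns at `a` or at `b` decides whether multiplying by `swap a b` merges or splits
cycles. -/
theorem exists_first_pow [Finite H] (π : Perm H) (a b : H) :
    ∃ m, 0 < m ∧ ((π ^ m) a = a ∨ (π ^ m) a = b) ∧
      ∀ j, 0 < j → j < m → (π ^ j) a ≠ a ∧ (π ^ j) a ≠ b := by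
  classical
  have hex : ∃ m, 0 < m ∧ ((π ^ m) a = a ∨ (π ^ m) a = b) :=
    ⟨orderOf π, orderOf_pos π, Or.inl (by rw [pow_orderOf_eq_one]; rfl)⟩
  refine ⟨Nat.find hex, (Nat.find_spec hex).1, (Nat.find_spec hex).2, fun j hj hjm => ?_⟩
  have := Nat.find_min hex hjm
  push Not at this
  exact this hj

theorem mul_swap_pow_apply (π : Perm H) (a b : H) {m : ℕ}
    (h : ∀ j, 0 < j → j < m → (π ^ j) a ≠ a ∧ (π ^ j) a ≠ b) {j : ℕ} (hj : 0 < j) (hjm : j ≤ m) :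
    ((π * swap a b) ^ j) b = (π ^ j) a := by
  induction j, hj using Nat.le_induction with
  | base => simp
  | succ j hj ih =>
    have hj' := h j hj (by omega)
    rw [pow_succ', mul_apply, ih (by omega), mul_apply, swap_apply_of_ne_of_ne hj'.1 hj'.2,
      pow_succ', mul_apply]

/-- Started at `b`, the product runs through the `π`-cycle of `a` and arrives at `a`, from where it
continues into the cycle of `b`: the two cycles are concatenated. -/
theorem cycles_mul_swap [Finite H] {π : Perm H} {a b : H} (hab : ¬ SameCycle π a b) :
    SameCycle.setoid (π * swap a b) = glue (SameCycle.setoid π) a b := by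
  have hba : SameCycle (π * swap a b) b a := by
    obtain ⟨m, hm, hma, hlt⟩ := exists_first_pow π a b
    have := mul_swap_pow_apply π a b hlt hm le_rfl
    rcases hma with hma | hma
    · exact ⟨m, by rw [zpow_natCast, this, hma]⟩
    · exact absurd ⟨m, by rw [zpow_natCast, hma]⟩ hab
  have ha' : SameCycle (π * swap a b) b (π a) :=
    ⟨1, by simp⟩
  have hb' : SameCycle (π * swap a b) a (π b) :=
    ⟨1, by simp⟩
  apply le_antisymm
  · rw [cycles_le_iff]
    intro x
    set t := glue (SameCycle.setoid π) a b
    have hπ : ∀ x, t x (π x) := fun x =>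
      le_glue _ a b (sameCycle_apply_right.2 (SameCycle.refl π x))
    have hab' : t a b := glue_rel _ a b
    rw [mul_apply]
    by_cases hxa : x = a
    · rw [hxa, swap_apply_left]; exact t.trans hab' (hπ b)
    by_cases hxb : x = b
    · rw [hxb, swap_apply_right]; exact t.trans (t.symm hab') (hπ a)
    · rw [swap_apply_of_ne_of_ne hxa hxb]; exact hπ x
  · rw [glue_le_iff, cycles_le_iff]
    refine ⟨fun x => ?_, hba.symm⟩
    by_cases hxa : x = a
    · rw [hxa]; exact hba.symm.trans ha'
    by_cases hxb : x = b
    · rw [hxb]; exact hba.trans hb'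
    · exact ⟨1, by rw [zpow_one, mul_apply, swap_apply_of_ne_of_ne hxa hxb]⟩

/-- The `π`-orbit of `a` meets `b` before it returns to `a`. Under the product, `b` follows exactly
this stretch and closes up at `b`, never passing `a`. -/
theorem not_sameCycle_mul_swap [Finite H] {π : Perm H} {a b : H} (hne : a ≠ b)
    (hab : SameCycle π a b) : ¬ SameCycle (π * swap a b) a b := by
  obtain ⟨m, hm, hma, hlt⟩ := exists_first_pow π a b
  have hmb : (π ^ m) a = b := by
    rcases hma with hma | hma
    · exfalso
      obtain ⟨i, hi⟩ := hab.exists_nat_pow_eq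
      have hper : (π ^ (i % m)) a = b := by
        rw [← hi]
        conv_rhs => rw [← Nat.mod_add_div i m, pow_add, mul_apply, pow_mul]
        have : ∀ k, ((π ^ m) ^ k) a = a := fun k => by
          induction k with
          | zero => rfl
          | succ k ih => rw [pow_succ, mul_apply, hma, ih]
        rw [this]
      rcases Nat.eq_zero_or_pos (i % m) with h0 | h0
      · rw [h0] at hper; exact hne hper
      · exact (hlt _ h0 (Nat.mod_lt _ hm)).2 hper
    · exact hma
  intro h
  obtain ⟨i, hi⟩ := h.symm.exists_nat_pow_eq
  have hbb : ((π * swap a b) ^ m) b = b := by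
    rw [mul_swap_pow_apply π a b hlt hm le_rfl, hmb]
  have hper : ((π * swap a b) ^ (i % m)) b = a := by
    refine Eq.trans ?_ hi
    conv_rhs => rw [← Nat.mod_add_div i m, pow_add, mul_apply, pow_mul]
    have : ∀ k, (((π * swap a b) ^ m) ^ k) b = b := fun k => by
      induction k with
      | zero => rfl
      | succ k ih => rw [pow_succ, mul_apply, hbb, ih]
    rw [this]
  rcases Nat.eq_zero_or_pos (i % m) with h0 | h0
  · rw [h0] at hper; exact hne hper.symm
  · rw [mul_swap_pow_apply π a b hlt h0 (Nat.mod_lt _ hm).le] at hper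
    exact (hlt _ h0 (Nat.mod_lt _ hm)).1 hper

theorem mul_swap_mul_swap (π : Perm H) (a b : H) : π * swap a b * swap a b = π := by
  rw [mul_assoc, swap_mul_self, mul_one]

theorem cycles_eq_glue_mul_swap [Finite H] {π : Perm H} {a b : H} (hne : a ≠ b)
    (hab : SameCycle π a b) :
    SameCycle.setoid π = glue (SameCycle.setoid (π * swap a b)) a b := by
  rw [← cycles_mul_swap (not_sameCycle_mul_swap hne hab), mul_swap_mul_swap]

/-- Cutting a vertex multiplies the face permutation by a transposition too, so the same merge/split
dichotomy governs the faces. -/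
theorem mul_swap_mul (σ α : Perm H) (a b : H) :
    σ * swap a b * α = σ * α * swap (α.symm a) (α.symm b) := by
  ext x
  simp only [mul_apply]
  by_cases hxa : α x = a
  · have hx : x = α.symm a := by rw [← hxa, symm_apply_apply]
    rw [hxa, hx, swap_apply_left, swap_apply_left, apply_symm_apply]
  by_cases hxb : α x = b
  · have hx : x = α.symm b := by rw [← hxb, symm_apply_apply]
    rw [hxb, hx, swap_apply_right, swap_apply_right, apply_symm_apply]
  · rw [swap_apply_of_ne_of_ne hxa hxb, swap_apply_of_ne_of_ne]
    · exact fun h => hxa (by rw [h, apply_symm_apply])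
    · exact fun h => hxb (by rw [h, apply_symm_apply])

/-- The equivalence relation whose classes are the components of the map with the given
permutations. -/
abbrev components (σ α : Perm H) : Setoid H := SameCycle.setoid σ ⊔ SameCycle.setoid α

omit [DecidableEq H] in
theorem cycles_mul_le_components (σ α : Perm H) :
    SameCycle.setoid (σ * α) ≤ components σ α := by
  rw [cycles_le_iff]
  intro x
  refine (components σ α).trans (b := α x) ?_ ?_
  · exact (le_sup_right : _ ≤ components σ α) (sameCycle_apply_right.2 (SameCycle.refl α x))
  · exact (le_sup_left : _ ≤ components σ α) (sameCycle_apply_right.2 (SameCycle.refl σ (α x)))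

/-- If the cut joins two different faces, both ends of the cut lie on the joined face, so they
remain connected. -/
theorem components_mul_swap_of_not_sameCycle [Finite H] {σ α : Perm H} {a b : H}
    (h : ¬ SameCycle (σ * α) (α.symm a) (α.symm b)) : components (σ * swap a b) α a b := by
  set t := components (σ * swap a b) α
  have hle := cycles_mul_le_components (σ * swap a b) α
  rw [mul_swap_mul, cycles_mul_swap h, glue_le_iff] at hle
  have hα : ∀ x, t (α.symm x) x := fun x => (le_sup_right : SameCycle.setoid α ≤ t)
    (sameCycle_symm_apply_left.2 (SameCycle.refl α x))
  exact t.trans (t.symm (hα a)) (t.trans hle.2 (hα b))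

/-- The genus of a combinatorial map is not negative. -/
theorem genus_nonneg [Fintype H] (σ α : Perm H) {S : Finset H} (hσ : ∀ x ∈ S, σ x ∈ S)
    (hα : ∀ x ∈ S, α x ∈ S) :
    classCount (SameCycle.setoid σ) S + classCount (SameCycle.setoid α) S +
        classCount (SameCycle.setoid (σ * α)) S ≤
      S.card + 2 * classCount (components σ α) S := by
  induction hk : (S.filter fun x => σ x ≠ x).card using Nat.strong_induction_on generalizing σ with
  | _ k ih =>
  subst hk
  by_cases hfix : ∀ x ∈ S, σ x = x
  · have h1 : classCount (SameCycle.setoid σ) S = S.card :=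
      classCount_of_forall_eq fun x hx y _ hxy => SameCycle.eq_of_left hxy (hfix x hx)
    have hsatα := saturated_cycles_iff.2 hα
    have h2 : classCount (SameCycle.setoid (σ * α)) S = classCount (SameCycle.setoid α) S := by
      refine classCount_congr fun x hx y hy => ?_
      have : ∀ (i : ℕ), ((σ * α) ^ i) x = (α ^ i) x ∧ (α ^ i) x ∈ S := by
        intro i
        induction i with
        | zero => exact ⟨rfl, hx⟩
        | succ i ih =>
          have hm : (α ^ (i + 1)) x ∈ S := by rw [pow_succ']; exact hα _ ih.2
          refine ⟨?_, hm⟩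
          rw [pow_succ', mul_apply, ih.1, mul_apply]
          rw [pow_succ', mul_apply] at hm ⊢
          exact hfix _ hm
      constructor
      · intro h
        obtain ⟨i, hi⟩ := SameCycle.exists_nat_pow_eq h
        exact ⟨i, by rw [zpow_natCast, ← (this i).1, hi]⟩
      · intro h
        obtain ⟨i, hi⟩ := SameCycle.exists_nat_pow_eq h
        exact ⟨i, by rw [zpow_natCast, (this i).1, hi]⟩
    have h3 : classCount (SameCycle.setoid α) S ≤ classCount (components σ α) S := by
      -- `σ` is known to be trivial only on `S`, so everything outside `S` is lumped together; on
      -- `S` this relation still has just the `α`-cycles as classes.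
      let t : Setoid H :=
        { r := fun x y => SameCycle α x y ∨ (x ∉ S ∧ y ∉ S)
          iseqv := by
            refine ⟨fun x => Or.inl (SameCycle.refl α x), ?_, ?_⟩
            · rintro x y (h | h)
              · exact Or.inl h.symm
              · exact Or.inr h.symm
            · rintro x y z (h | h) (h' | h')
              · exact Or.inl (h.trans h')
              · exact Or.inr ⟨fun hx => h'.1 (hsatα x y h hx), h'.2⟩
              · exact Or.inr ⟨h.1, fun hz => h.2 (hsatα z y h'.symm hz)⟩
              · exact Or.inr ⟨h.1, h'.2⟩ }
      have hle : components σ α ≤ t := by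
        refine sup_le (cycles_le_iff.2 fun x => ?_) fun x y h => Or.inl h
        by_cases hx : x ∈ S
        · rw [hfix x hx]
        · refine Or.inr ⟨hx, fun h => hx ?_⟩
          exact saturated_cycles_iff.2 hσ _ _ (sameCycle_apply_left.2 (SameCycle.refl σ x)) h
      refine le_trans (le_of_eq ?_) (classCount_anti hle S)
      refine classCount_congr fun x hx y hy => ?_
      exact ⟨Or.inl, fun h => h.elim id fun h => absurd hx h.1⟩
    omega
  · push Not at hfix
    obtain ⟨a, ha, hne⟩ := hfix
    -- With this `b` the product `σ * swap a b` fixes `a`: the cut isolates `a`, and fewer points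
    -- are moved.
    set b := σ.symm a with hb
    have hσb : σ b = a := apply_symm_apply σ a
    have hab : a ≠ b := fun h => hne (by conv_lhs => rw [h]
                                         rw [hσb])
    have hbS : b ∈ S := saturated_cycles_iff.2 hσ a b
      (by rw [hb]; exact sameCycle_symm_apply_right.2 (SameCycle.refl σ a)) ha
    have hsame : SameCycle σ a b := by
      rw [hb]; exact sameCycle_symm_apply_right.2 (SameCycle.refl σ a)
    have hσ' : ∀ x ∈ S, (σ * swap a b) x ∈ S := by
      intro x hx
      rw [mul_apply]
      apply hσ
      by_cases hxa : x = a
      · rw [hxa, swap_apply_left]; exact hbS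
      by_cases hxb : x = b
      · rw [hxb, swap_apply_right]; exact ha
      · rwa [swap_apply_of_ne_of_ne hxa hxb]
    have hlt : (S.filter fun x => (σ * swap a b) x ≠ x).card <
        (S.filter fun x => σ x ≠ x).card := by
      apply Finset.card_lt_card
      rw [Finset.ssubset_iff_of_subset]
      · refine ⟨a, Finset.mem_filter.2 ⟨ha, hne⟩, ?_⟩
        simp [hb]
      · intro x hx
        rw [Finset.mem_filter] at hx ⊢
        refine ⟨hx.1, fun hxx => hx.2 ?_⟩
        have hxa : x ≠ a := fun h => hne (h ▸ hxx)
        have hxb : x ≠ b := fun h => hab (by rw [← hσb, ← h, hxx, h])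
        rw [mul_apply, swap_apply_of_ne_of_ne hxa hxb, hxx]
    have IH := ih _ hlt (σ * swap a b) hσ' rfl
    have hn : classCount (SameCycle.setoid σ) S + 1 =
        classCount (SameCycle.setoid (σ * swap a b)) S := by
      rw [cycles_eq_glue_mul_swap hab hsame]
      exact classCount_glue (not_sameCycle_mul_swap hab hsame) ha hbS
    have hK : components σ α = glue (components (σ * swap a b) α) a b := by
      rw [components, cycles_eq_glue_mul_swap hab hsame, glue_sup]
    rw [mul_swap_mul] at IH
    set a' := α.symm a with ha'
    set b' := α.symm b with hb'
    have hab' : a' ≠ b' := fun h => hab (α.symm.injective h)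
    have ha'S : a' ∈ S := saturated_cycles_iff.2 hα a a'
      (by rw [ha']; exact sameCycle_symm_apply_right.2 (SameCycle.refl α a)) ha
    have hb'S : b' ∈ S := saturated_cycles_iff.2 hα b b'
      (by rw [hb']; exact sameCycle_symm_apply_right.2 (SameCycle.refl α b)) hbS
    -- The cut adds a vertex. If it splits a face, there is one more face and at most one more
    -- component; if it joins two faces, there is one face fewer and the components stay the same.
    -- Either way the bound for the cut map implies the bound for the original one.
    by_cases hφ : SameCycle (σ * α) a' b'
    · have h1 : classCount (SameCycle.setoid (σ * α)) S + 1 =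
          classCount (SameCycle.setoid (σ * α * swap a' b')) S := by
        rw [cycles_eq_glue_mul_swap hab' hφ]
        exact classCount_glue (not_sameCycle_mul_swap hab' hφ) ha'S hb'S
      have h2 := classCount_le_glue_add_one (components (σ * swap a b) α) a b ha hbS
      rw [← hK] at h2
      omega
    · have h1 := cycles_mul_swap hφ
      have h2 : classCount (SameCycle.setoid (σ * α * swap a' b')) S + 1 =
          classCount (SameCycle.setoid (σ * α)) S := by
        rw [h1]; exact classCount_glue hφ ha'S hb'S
      have h3 := components_mul_swap_of_not_sameCycle hφ
      rw [glue_eq_self h3] at hK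
      rw [hK]
      omega

end Cycles

/-! ### Turning numbers of the faces of a planar map -/

section Turning

open Equiv Perm

variable {H : Type*}

theorem Saturated.glue {r : Setoid H} {S : Finset H} {a b : H} (hS : Saturated r S)
    (hab : a ∈ S ↔ b ∈ S) : Saturated (glue r a b) S := by
  have h : _root_.glue r a b ≤ Setoid.ker (· ∈ S) :=
    glue_le_iff.2 ⟨fun x y hxy => propext ⟨hS x y hxy, hS y x (r.symm hxy)⟩, propext hab⟩
  intro x y hxy hx
  have : (x ∈ S) = (y ∈ S) := h hxy
  exact this ▸ hx

theorem glue_rel_iff_of_not {r : Setoid H} {a b c x : H} (ha : ¬ r c a) (hb : ¬ r c b) :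
    glue r a b c x ↔ r c x := by
  refine ⟨fun h => ?_, fun h => le_glue r a b h⟩
  rw [glue, Setoid.ker_def, if_neg hb] at h
  split_ifs at h
  · exact absurd (Quotient.eq.1 h) ha
  · exact Quotient.eq.1 h

theorem glue_rel_left_iff {r : Setoid H} {a b x : H} :
    glue r a b a x ↔ r a x ∨ r b x := by
  constructor
  · intro h
    rw [glue, Setoid.ker_def] at h
    by_cases hx : r x b
    · exact Or.inr (r.symm hx)
    · rw [if_neg hx] at h
      split_ifs at h <;> exact Or.inl (Quotient.eq.1 h)
  · rintro (h | h)
    · exact le_glue r a b h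
    · exact (glue r a b).trans (glue_rel r a b) (le_glue r a b h)

/-- The number of faces in `U` minus their total turning number. -/
noncomputable def defect (φ : Perm H) (τ : H → ℝ) (U : Finset H) : ℝ :=
  classCount (SameCycle.setoid φ) U - ∑ x ∈ U, τ x

theorem defect_sdiff_add [DecidableEq H] {φ : Perm H} (τ : H → ℝ) {S T : Finset H}
    (hT : Saturated (SameCycle.setoid φ) T) (hTS : T ⊆ S) :
    defect φ τ (S \ T) + defect φ τ T = defect φ τ S := by
  unfold defect
  rw [← classCount_sdiff_add hT hTS, ← Finset.sum_sdiff hTS]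
  push_cast
  ring

/-- The turning numbers of all faces of a planar map are those of a drawing in the plane: in every
component, one face has turning number `-1` and all others have turning number `1`. -/
structure PlanarTurning [Fintype H] (σ α : Perm H) (τ : H → ℝ) : Prop where
  even : ∀ U, Saturated (SameCycle.setoid (σ * α)) U → ∃ k : ℕ, defect (σ * α) τ U = 2 * k
  component : ∀ a, defect (σ * α) τ (classOf (components σ α) a) = 2

/-- The defects of a face and of the rest of its component are nonnegative even numbers with sum 2,
so the face has defect 0 or 2, which means turning number 1 or -1. -/
theorem PlanarTurning.sum_class [Fintype H] [DecidableEq H] {σ α : Perm H} {τ : H → ℝ}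
    (h : PlanarTurning σ α τ) (a : H) :
    ∑ x ∈ classOf (SameCycle.setoid (σ * α)) a, τ x = 1 ∨
      ∑ x ∈ classOf (SameCycle.setoid (σ * α)) a, τ x = -1 := by
  set F := classOf (SameCycle.setoid (σ * α)) a
  set S := classOf (components σ α) a
  have hF : Saturated (SameCycle.setoid (σ * α)) F := saturated_classOf _ a
  have hS : Saturated (SameCycle.setoid (σ * α)) S :=
    (saturated_classOf _ a).mono (cycles_mul_le_components σ α)
  have hFS : F ⊆ S := fun x hx =>
    mem_classOf.2 (cycles_mul_le_components σ α (mem_classOf.1 hx))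
  obtain ⟨k, hk⟩ := h.even F hF
  obtain ⟨l, hl⟩ := h.even (S \ F) (hS.sdiff hF)
  have hadd := defect_sdiff_add τ hF hFS
  have hcomp : defect (σ * α) τ S = 2 := h.component a
  rw [hk, hl, hcomp] at hadd
  have hkl : l + k = 1 := by
    have : ((l + k : ℕ) : ℝ) = 1 := by push_cast; linarith
    exact_mod_cast this
  have hdef : defect (σ * α) τ F = 1 - ∑ x ∈ F, τ x := by
    unfold defect
    rw [classCount_classOf]
    norm_num
  rw [hdef] at hk
  rcases Nat.eq_zero_or_pos k with h0 | h0
  · left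
    rw [h0] at hk
    push_cast at hk
    linarith
  · right
    have : k = 1 := by omega
    rw [this] at hk
    push_cast at hk
    linarith

/-- Cutting a vertex of a planar map into two preserves the turning numbers of drawings. -/
theorem PlanarTurning.mul_swap [Fintype H] [DecidableEq H] {σ α : Perm H} {τ τ' : H → ℝ}
    (h : PlanarTurning σ α τ) {a b : H} (hne : a ≠ b) (hab : SameCycle σ a b)
    (hτ : ∀ x, x ≠ α.symm a → x ≠ α.symm b → τ' x = τ x)
    (hsum : τ' (α.symm a) + τ' (α.symm b) = τ (α.symm a) + τ (α.symm b) - 1)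
    (hgenus : ∀ S, Saturated (components (σ * swap a b) α) S →
      defect (σ * swap a b * α) τ' S ≤ 2 * classCount (components (σ * swap a b) α) S) :
    PlanarTurning (σ * swap a b) α τ' := by
  have hK : components σ α = _root_.glue (components (σ * swap a b) α) a b := by
    rw [components, cycles_eq_glue_mul_swap hne hab, glue_sup]
  have hle' := cycles_mul_le_components (σ * swap a b) α
  have hnotboth := components_mul_swap_of_not_sameCycle (σ := σ) (α := α) (a := a) (b := b)
  obtain ⟨heven, hcomp⟩ := h
  set K' := components (σ * swap a b) α with hK'
  set a' := α.symm a with ha'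
  set b' := α.symm b with hb'
  have hne' : a' ≠ b' := fun h => hne (α.symm.injective h)
  have haa : K' a' a := (le_sup_right : SameCycle.setoid α ≤ K')
    (sameCycle_symm_apply_left.2 (SameCycle.refl α a))
  have hbb : K' b' b := (le_sup_right : SameCycle.setoid α ≤ K')
    (sameCycle_symm_apply_left.2 (SameCycle.refl α b))
  have hφ' : σ * swap a b * α = σ * α * swap a' b' := mul_swap_mul σ α a b
  rw [hφ'] at hgenus hle'
  set φ := σ * α with hφ
  have sum_neither : ∀ U : Finset H, a' ∉ U → b' ∉ U → ∑ x ∈ U, τ' x = ∑ x ∈ U, τ x :=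
    fun U ha hb => Finset.sum_congr rfl fun x hx =>
      hτ x (fun h => ha (h ▸ hx)) (fun h => hb (h ▸ hx))
  have sum_both : ∀ U : Finset H, a' ∈ U → b' ∈ U → ∑ x ∈ U, τ' x = ∑ x ∈ U, τ x - 1 := by
    intro U ha hb
    have hsub : ({a', b'} : Finset H) ⊆ U := by
      intro x hx
      rcases Finset.mem_insert.1 hx with rfl | hx
      · exact ha
      · rw [Finset.mem_singleton.1 hx]; exact hb
    rw [← Finset.sum_sdiff hsub, ← Finset.sum_sdiff (f := τ) hsub, Finset.sum_pair hne',
      Finset.sum_pair hne', sum_neither (U \ {a', b'}) (by simp) (by simp)]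
    linarith
  -- Either the cut splits a face, which raises the defect of the component by 2 and must disconnect
  -- it, or it joins two faces, which loses one face and one full turn and leaves all defects and
  -- components as they were.
  by_cases hF : SameCycle φ a' b'
  · have hcyc := cycles_eq_glue_mul_swap hne' hF
    have hnot := not_sameCycle_mul_swap hne' hF
    set φ' := φ * swap a' b' with hφdef
    have neither : ∀ U, Saturated (SameCycle.setoid φ') U → a' ∉ U → b' ∉ U →
        Saturated (SameCycle.setoid φ) U ∧ defect φ' τ' U = defect φ τ U := by
      intro U hU ha hb
      rw [hcyc]
      refine ⟨hU.glue (by tauto), ?_⟩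
      rw [defect, defect, sum_neither U ha hb, hcyc, classCount_glue_of_notMem hU hb]
    have both : ∀ U, Saturated (SameCycle.setoid φ') U → a' ∈ U → b' ∈ U →
        Saturated (SameCycle.setoid φ) U ∧ defect φ' τ' U = defect φ τ U + 2 := by
      intro U hU ha hb
      rw [hcyc]
      refine ⟨hU.glue (by tauto), ?_⟩
      rw [defect, defect, sum_both U ha hb, hcyc, ← classCount_glue hnot ha hb]
      push_cast
      ring
    set S := classOf (components σ α) a with hS
    have hSa : Saturated (components σ α) S := saturated_classOf _ a
    have hSK' : Saturated K' S := hSa.mono (by rw [hK]; exact le_glue _ _ _)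
    have haS : a ∈ S := self_mem_classOf _ a
    have hbS : b ∈ S := by rw [hS, mem_classOf, hK]; exact glue_rel _ _ _
    have ha'S : a' ∈ S := hSK' a a' (K'.symm haa) haS
    have hb'S : b' ∈ S := hSK' b b' (K'.symm hbb) hbS
    have hΔS : defect φ τ S = 2 := hcomp a
    have hΔ'S : defect φ' τ' S = 4 := by
      rw [(both S (hSK'.mono hle') ha'S hb'S).2, hΔS]; norm_num
    -- A connected map has defect at most 2 by the genus bound, but here the defect is 4.
    have hsep : ¬ K' a b := by
      intro hK'ab
      have := hgenus S hSK'
      rw [hΔ'S, ← glue_eq_self hK'ab, ← hK, hS, classCount_classOf] at this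
      norm_num at this
    have hP : ∀ p, Saturated K' (classOf K' p) := fun p => saturated_classOf K' p
    have hPle : ∀ p, defect φ' τ' (classOf K' p) ≤ 2 := by
      intro p
      have := hgenus _ (hP p)
      rwa [classCount_classOf, Nat.cast_one, mul_one] at this
    have hsub : ∀ p, K' p a ∨ K' p b → classOf K' p ⊆ S := by
      intro p hp x hx
      rw [mem_classOf] at hx
      rw [hS, mem_classOf, hK, glue_rel_left_iff]
      exact hp.imp (fun hp => K'.trans (K'.symm hp) hx) fun hp => K'.trans (K'.symm hp) hx
    have hdiff : S \ classOf K' a = classOf K' b := by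
      ext x
      rw [Finset.mem_sdiff, hS, mem_classOf, mem_classOf, mem_classOf, hK, glue_rel_left_iff]
      have : K' b x → ¬ K' a x := fun h1 h2 => hsep (K'.trans h2 (K'.symm h1))
      tauto
    have hadd := defect_sdiff_add τ' ((hP a).mono hle') (hsub a (Or.inl (K'.refl a)))
    rw [hdiff, hΔ'S] at hadd
    have hΔa : defect φ' τ' (classOf K' a) = 2 := by linarith [hPle a, hPle b]
    have hΔb : defect φ' τ' (classOf K' b) = 2 := by linarith [hPle a, hPle b]
    -- The remaining case is a union `U` of faces that contains only one of the two new faces. The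
    -- parts of `U` outside the new component `P`, and of `P` outside `U`, consist of old faces. The
    -- defect of `U ∩ P` is 2 minus that of `P \ U`, which is 0 or 2 because `P \ U` lies in the old
    -- component `S` of defect 2.
    have only : ∀ c p q, (p = a' ∧ q = b' ∨ p = b' ∧ q = a') → (K' c a ∨ K' c b) → K' c p →
        ¬ K' c q → defect φ' τ' (classOf K' c) = 2 → ∀ U, Saturated (SameCycle.setoid φ') U →
        p ∈ U → q ∉ U → ∃ k : ℕ, defect φ' τ' U = 2 * k := by
      intro c p q hpq hc hcp hcq hΔ U hU hp hq
      set P := classOf K' c with hPdef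
      have hPsat : Saturated (SameCycle.setoid φ') P := (hP c).mono hle'
      have hpP : p ∈ P := mem_classOf.2 hcp
      have hqP : q ∉ P := fun h => hcq (mem_classOf.1 h)
      have neither' : ∀ V, Saturated (SameCycle.setoid φ') V → p ∉ V → q ∉ V →
          Saturated (SameCycle.setoid φ) V ∧ defect φ' τ' V = defect φ τ V := by
        intro V hV hpV hqV
        rcases hpq with ⟨rfl, rfl⟩ | ⟨rfl, rfl⟩
        · exact neither V hV hpV hqV
        · exact neither V hV hqV hpV
      have hU1 := hU.inter hPsat
      obtain ⟨h2, e2⟩ := neither' (U \ (U ∩ P)) (hU.sdiff hU1) (by simp [hpP])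
        (by simp [hq])
      obtain ⟨k₂, hk₂⟩ := heven _ h2
      obtain ⟨h3, e3⟩ := neither' (P \ (U ∩ P)) (hPsat.sdiff hU1) (by simp [hp])
        (by simp [hqP])
      obtain ⟨k₃, hk₃⟩ := heven _ h3
      have hSsat : Saturated (SameCycle.setoid φ) S := hSa.mono (cycles_mul_le_components σ α)
      obtain ⟨k₄, hk₄⟩ := heven _ (hSsat.sdiff h3)
      have s1 := defect_sdiff_add τ' hU1 (Finset.inter_subset_left : U ∩ P ⊆ U)
      have s2 := defect_sdiff_add τ' hU1 (Finset.inter_subset_right : U ∩ P ⊆ P)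
      have s3 := defect_sdiff_add τ h3 ((Finset.sdiff_subset).trans (hsub c hc))
      rw [hk₃, hk₄, hΔS] at s3
      rw [e3, hk₃, hΔ] at s2
      rw [e2, hk₂] at s1
      have hk : k₄ + k₃ = 1 := by
        have : ((k₄ + k₃ : ℕ) : ℝ) = 1 := by push_cast; linarith
        exact_mod_cast this
      refine ⟨k₂ + k₄, ?_⟩
      push_cast
      linarith
    refine ⟨fun U hU => ?_, fun c => ?_⟩
    · rw [hφ'] at hU ⊢
      by_cases ha : a' ∈ U <;> by_cases hb : b' ∈ U
      · obtain ⟨hU', e⟩ := both U hU ha hb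
        obtain ⟨k, hk⟩ := heven U hU'
        exact ⟨k + 1, by rw [e, hk]; push_cast; ring⟩
      · refine only a a' b' (Or.inl ⟨rfl, rfl⟩) (Or.inl (K'.refl a)) (K'.symm haa) ?_ hΔa U hU ha hb
        exact fun h => hsep (K'.trans h hbb)
      · refine only b b' a' (Or.inr ⟨rfl, rfl⟩) (Or.inr (K'.refl b)) (K'.symm hbb) ?_ hΔb U hU hb ha
        exact fun h => hsep (K'.symm (K'.trans h haa))
      · obtain ⟨hU', e⟩ := neither U hU ha hb
        obtain ⟨k, hk⟩ := heven U hU'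
        exact ⟨k, by rw [e, hk]⟩
    · rw [hφ']
      have hclass : ∀ p q, K' p q → classOf K' p = classOf K' q := by
        intro p q hpq
        ext x
        rw [mem_classOf, mem_classOf]
        exact ⟨K'.trans (K'.symm hpq), K'.trans hpq⟩
      by_cases hca : K' c a
      · rw [hclass c a hca, hΔa]
      by_cases hcb : K' c b
      · rw [hclass c b hcb, hΔb]
      · have : classOf K' c = classOf (components σ α) c := by
          ext x
          rw [mem_classOf, mem_classOf, hK, glue_rel_iff_of_not hca hcb]
        rw [(neither (classOf K' c) ((hP c).mono hle')
          (fun h => hca (K'.trans (mem_classOf.1 h) haa))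
          (fun h => hcb (K'.trans (mem_classOf.1 h) hbb))).2, this, hcomp c]
  · have hcyc := cycles_mul_swap hF
    have hK'ab := hnotboth hF
    rw [glue_eq_self hK'ab] at hK
    have key : ∀ U, Saturated (SameCycle.setoid (φ * swap a' b')) U →
        Saturated (SameCycle.setoid φ) U ∧ defect (φ * swap a' b') τ' U = defect φ τ U := by
      intro U hU
      rw [hcyc] at hU
      have hU' := hU.mono (le_glue _ _ _)
      refine ⟨hU', ?_⟩
      have hiff : a' ∈ U ↔ b' ∈ U :=
        ⟨hU _ _ (glue_rel _ _ _), hU _ _ ((glue (SameCycle.setoid φ) a' b').symm (glue_rel _ _ _))⟩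
      rw [defect, defect, hcyc]
      by_cases ha : a' ∈ U
      · rw [sum_both U ha (hiff.1 ha), ← classCount_glue (r := SameCycle.setoid φ) hF ha (hiff.1 ha)]
        push_cast
        ring
      · have hb : b' ∉ U := fun h => ha (hiff.2 h)
        rw [sum_neither U ha hb, classCount_glue_of_notMem hU' hb]
    refine ⟨fun U hU => ?_, fun c => ?_⟩
    · rw [hφ'] at hU ⊢
      obtain ⟨hU', e⟩ := key U hU
      rw [e]
      exact heven U hU'
    · rw [hφ', (key _ ((saturated_classOf K' c).mono hle')).2, ← hK]
      exact hcomp c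

end Turning

/-! ### Smoothing the crossings one by one -/

section Smoothing

open Equiv Perm

variable {n : ℕ}

theorem sum_side {M : Type*} [AddCommMonoid M] (f : Side → M) :
    ∑ t, f t = f .left + f .right := by
  have : (Finset.univ : Finset Side) = {.left, .right} := rfl
  rw [this, Finset.sum_pair (by simp)]

theorem prod_side {M : Type*} [CommMonoid M] (f : Side → M) :
    ∏ t, f t = f .left * f .right := by
  have : (Finset.univ : Finset Side) = {.left, .right} := rfl
  rw [this, Finset.prod_pair (by simp)]

/-- Half-edges are outgoing or incoming ports. -/
def halfEdgeEquiv (n : ℕ) : HalfEdge n ≃ Port n ⊕ Port n where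
  toFun
    | .outgoing p => .inl p
    | .incoming p => .inr p
  invFun
    | .inl p => .outgoing p
    | .inr p => .incoming p
  left_inv h := by cases h <;> rfl
  right_inv h := by cases h <;> rfl

theorem sum_halfEdge {M : Type*} [AddCommMonoid M] (f : HalfEdge n → M) :
    ∑ h, f h = ∑ p, f (.outgoing p) + ∑ p, f (.incoming p) := by
  rw [← (halfEdgeEquiv n).symm.sum_comp, Fintype.sum_sum_type]
  rfl

theorem sum_halfEdge_by_crossing {M : Type*} [AddCommMonoid M] (f : HalfEdge n → M) :
    ∑ h, f h = ∑ v, (f (.outgoing (v, .left)) + f (.outgoing (v, .right)) +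
      (f (.incoming (v, .left)) + f (.incoming (v, .right)))) := by
  rw [sum_halfEdge, Fintype.sum_prod_type, Fintype.sum_prod_type, ← Finset.sum_add_distrib]
  simp only [sum_side]

theorem card_halfEdge (n : ℕ) : Fintype.card (HalfEdge n) = 4 * n := by
  rw [Fintype.card_congr (halfEdgeEquiv n), Fintype.card_sum, Fintype.card_prod, Fintype.card_fin]
  have : Fintype.card Side = 2 := rfl
  rw [this]
  ring

/-- The rotation around the vertices after smoothing the crossings `v` with `st v ≠ none`. -/
def stagePerm (st : Fin n → Option Smoothing) : Perm (HalfEdge n) where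
  toFun
    | .incoming (v, .left) => match st v with
      | some .disoriented => .incoming (v, .right)
      | _ => .outgoing (v, .left)
    | .outgoing (v, .left) => match st v with
      | some .oriented => .incoming (v, .left)
      | _ => .outgoing (v, .right)
    | .outgoing (v, .right) => match st v with
      | some .disoriented => .outgoing (v, .left)
      | _ => .incoming (v, .right)
    | .incoming (v, .right) => match st v with
      | some .oriented => .outgoing (v, .right)
      | _ => .incoming (v, .left)
  invFun
    | .outgoing (v, .left) => match st v with
      | some .disoriented => .outgoing (v, .right)
      | _ => .incoming (v, .left)
    | .incoming (v, .left) => match st v with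
      | some .oriented => .outgoing (v, .left)
      | _ => .incoming (v, .right)
    | .incoming (v, .right) => match st v with
      | some .disoriented => .incoming (v, .left)
      | _ => .outgoing (v, .right)
    | .outgoing (v, .right) => match st v with
      | some .oriented => .incoming (v, .right)
      | _ => .outgoing (v, .left)
  left_inv h := by
    rcases h with ⟨v, _ | _⟩ | ⟨v, _ | _⟩ <;> rcases hv : st v with _ | _ | _ <;> simp [hv]
  right_inv h := by
    rcases h with ⟨v, _ | _⟩ | ⟨v, _ | _⟩ <;> rcases hv : st v with _ | _ | _ <;> simp [hv]

/-- The turning at the corners after smoothing the crossings `v` with `st v ≠ none`. -/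
noncomputable def stageCorner (st : Fin n → Option Smoothing) : HalfEdge n → ℝ
  | .incoming (v, .left) => match st v with
    | some .disoriented => -1 / 2
    | _ => 0
  | .incoming (v, .right) => match st v with
    | some .oriented => 0
    | _ => 1 / 2
  | .outgoing (v, .left) => match st v with
    | some .oriented => 0
    | _ => 1 / 2
  | .outgoing (v, .right) => match st v with
    | some .disoriented => -1 / 2
    | _ => 0

/-- A half-edge in every cycle of `stagePerm st`. -/
def stageRoot (st : Fin n → Option Smoothing) : HalfEdge n → HalfEdge n
  | .incoming (v, .left) => .incoming (v, .left)
  | .incoming (v, .right) => match st v with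
    | some .oriented => .incoming (v, .right)
    | _ => .incoming (v, .left)
  | .outgoing (v, .left) => match st v with
    | some .disoriented => .outgoing (v, .right)
    | _ => .incoming (v, .left)
  | .outgoing (v, .right) => match st v with
    | none => .incoming (v, .left)
    | some .oriented => .incoming (v, .right)
    | some .disoriented => .outgoing (v, .right)

/-- The edge that a half-edge belongs to. -/
def edgeOf (next : Perm (Port n)) : HalfEdge n → Port n
  | .outgoing p => p
  | .incoming p => next.symm p

/-- The turning on the boundary of the faces, by half-edges. -/
noncomputable def stageTurn (next : Perm (Port n)) (r : Port n → ℝ)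
    (st : Fin n → Option Smoothing) (h : HalfEdge n) : ℝ :=
  edgeTurn next r h + stageCorner st (edgeFlip next h)

theorem stagePerm_none : stagePerm (fun _ : Fin n => none) = clockwise := by
  ext h
  rcases h with ⟨v, _ | _⟩ | ⟨v, _ | _⟩ <;> rfl

theorem stageCorner_none : stageCorner (fun _ : Fin n => none) = cornerTurn := by
  ext h
  rcases h with ⟨v, _ | _⟩ | ⟨v, _ | _⟩ <;> rfl

theorem edgeFlip_edgeFlip (next : Perm (Port n)) (h : HalfEdge n) :
    edgeFlip next (edgeFlip next h) = h := by
  cases h <;> simp [edgeFlip]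

theorem edgeFlip_symm (next : Perm (Port n)) : (edgeFlip next).symm = edgeFlip next := rfl

theorem edgeTurn_edgeFlip (next : Perm (Port n)) (r : Port n → ℝ) (h : HalfEdge n) :
    edgeTurn next r (edgeFlip next h) = -edgeTurn next r h := by
  cases h <;> simp [edgeFlip, edgeTurn]

theorem edgeOf_edgeFlip (next : Perm (Port n)) (h : HalfEdge n) :
    edgeOf next (edgeFlip next h) = edgeOf next h := by
  cases h <;> simp [edgeFlip, edgeOf]

theorem stageRoot_stagePerm (st : Fin n → Option Smoothing) (h : HalfEdge n) :
    stageRoot st (stagePerm st h) = stageRoot st h := by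
  rcases h with ⟨v, _ | _⟩ | ⟨v, _ | _⟩ <;> rcases hv : st v with _ | _ | _ <;>
    simp [stageRoot, stagePerm, hv]

theorem sum_comp_perm_of_mem {H M : Type*} [AddCommMonoid M] {π : Perm H}
    {S : Finset H} (hS : ∀ x ∈ S, π x ∈ S) (f : H → M) : ∑ x ∈ S, f (π x) = ∑ x ∈ S, f x := by
  classical
  have himg : S.image π = S := by
    apply Finset.eq_of_subset_of_card_le
    · intro y hy
      obtain ⟨x, hx, rfl⟩ := Finset.mem_image.1 hy
      exact hS x hx
    · rw [Finset.card_image_of_injective _ π.injective]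
  conv_rhs => rw [← himg]
  rw [Finset.sum_image fun x _ y _ h => π.injective h]

open Classical in
theorem classCount_mono {H : Type*} {r : Setoid H} {S T : Finset H} (h : S ⊆ T) :
    classCount r S ≤ classCount r T :=
  Finset.card_le_card (Finset.image_subset_image h)

/-- A function that is constant on cycles has at most one fixed point in each of them. -/
theorem card_filter_le_classCount {H : Type*} [DecidableEq H] {π : Perm H} {root : H → H}
    (h : ∀ x, root (π x) = root x) (S : Finset H) :
    (S.filter fun x => root x = x).card ≤ classCount (SameCycle.setoid π) S := by
  have hle : SameCycle.setoid π ≤ Setoid.ker root := cycles_le_iff.2 fun x => (h x).symm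
  rw [← classCount_of_forall_eq (r := SameCycle.setoid π) (S := S.filter fun x => root x = x)]
  · exact classCount_mono (Finset.filter_subset _ _)
  · intro x hx y hy hxy
    rw [← (Finset.mem_filter.1 hx).2, ← (Finset.mem_filter.1 hy).2]
    exact hle hxy

/-- Every edge is represented by its outgoing half, and the flip exchanges the halves that are
representatives with those that are not. -/
theorem card_le_two_mul_classCount_edgeFlip (next : Perm (Port n)) {S : Finset (HalfEdge n)}
    (hS : ∀ x ∈ S, edgeFlip next x ∈ S) :
    S.card ≤ 2 * classCount (SameCycle.setoid (edgeFlip next)) S := by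
  have h := card_filter_le_classCount (π := edgeFlip next)
    (root := fun h => .outgoing (edgeOf next h)) (fun x => by rw [edgeOf_edgeFlip]) S
  let ι : HalfEdge n → ℝ := fun x => if HalfEdge.outgoing (edgeOf next x) = x then 1 else 0
  have hι : ∀ x, ι (edgeFlip next x) = 1 - ι x := by
    intro x
    cases x <;> simp [ι, edgeFlip, edgeOf]
  have hsum := sum_comp_perm_of_mem hS ι
  simp only [hι, Finset.sum_sub_distrib, Finset.sum_const, nsmul_eq_mul, mul_one] at hsum
  have hcard : ((S.filter fun x => HalfEdge.outgoing (edgeOf next x) = x).card : ℝ) =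
      ∑ x ∈ S, ι x := by
    rw [Finset.card_filter]
    push_cast
    rfl
  have : (S.card : ℝ) = ((2 * (S.filter fun x =>
      HalfEdge.outgoing (edgeOf next x) = x).card : ℕ) : ℝ) := by
    push_cast
    rw [hcard]
    linarith
  have := Nat.cast_injective this
  omega

/-- The corners at a vertex with `m` half-edges turn by `m / 2 - 1` in total, whether the vertex is
a crossing (`m = 4`) or comes from a smoothing (`m = 2`). -/
theorem half_card_le_classCount_stagePerm (st : Fin n → Option Smoothing)
    {S : Finset (HalfEdge n)} (hS : ∀ x ∈ S, stagePerm st x ∈ S) :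
    (S.card : ℝ) / 2 ≤
      classCount (SameCycle.setoid (stagePerm st)) S + ∑ x ∈ S, stageCorner st x := by
  have h := card_filter_le_classCount (stageRoot_stagePerm st) S
  let ι : HalfEdge n → ℝ := fun x => if stageRoot st x = x then 1 else 0
  let u : HalfEdge n → ℝ := fun
    | .outgoing _ => 1 / 2
    | .incoming _ => 0
  -- The indicator of the representatives is `1 / 2 - stageCorner` up to a coboundary, which drops
  -- out of the sum over an invariant set.
  have hι : ∀ x, ι x = 1 / 2 - stageCorner st x + (u (stagePerm st x) - u x) := by
    intro x
    rcases x with ⟨v, _ | _⟩ | ⟨v, _ | _⟩ <;> rcases hv : st v with _ | _ | _ <;>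
      simp [ι, u, stageCorner, stagePerm, stageRoot, hv] <;> norm_num
  have hsum : ∑ x ∈ S, ι x = S.card / 2 - ∑ x ∈ S, stageCorner st x := by
    simp only [hι, Finset.sum_add_distrib, Finset.sum_sub_distrib, Finset.sum_const, nsmul_eq_mul]
    rw [sum_comp_perm_of_mem hS u]
    ring
  have hcard : ((S.filter fun x => stageRoot st x = x).card : ℝ) = ∑ x ∈ S, ι x := by
    rw [Finset.card_filter]
    push_cast
    rfl
  have h' : ((S.filter fun x => stageRoot st x = x).card : ℝ) ≤
      classCount (SameCycle.setoid (stagePerm st)) S := by exact_mod_cast h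
  linarith

/-- Every edge is run through in both directions, so the edge rotations cancel and only the corners
count. -/
theorem sum_stageTurn (next : Perm (Port n)) (r : Port n → ℝ) (st : Fin n → Option Smoothing)
    {S : Finset (HalfEdge n)} (hS : ∀ x ∈ S, edgeFlip next x ∈ S) :
    ∑ x ∈ S, stageTurn next r st x = ∑ x ∈ S, stageCorner st x := by
  unfold stageTurn
  rw [Finset.sum_add_distrib, sum_comp_perm_of_mem hS (stageCorner st)]
  have h := sum_comp_perm_of_mem hS (edgeTurn next r)
  simp only [edgeTurn_edgeFlip, Finset.sum_neg_distrib] at h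
  linarith

/-- With V, E, F, K vertices, edges, faces and components in `S`, the total turning is at least
`S.card / 2 - V`, while `S.card ≤ 2 * E`. Hence the defect is at most `V - E + F`-like data bounded
by 2K through `genus_nonneg`. -/
theorem defect_stage_le (next : Perm (Port n)) (r : Port n → ℝ) (st : Fin n → Option Smoothing)
    (S : Finset (HalfEdge n)) (hS : Saturated (components (stagePerm st) (edgeFlip next)) S) :
    defect (stagePerm st * edgeFlip next) (stageTurn next r st) S ≤
      2 * classCount (components (stagePerm st) (edgeFlip next)) S := by
  have hσ := saturated_cycles_iff.1 (hS.mono le_sup_left)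
  have hα := saturated_cycles_iff.1 (hS.mono le_sup_right)
  have h1 := half_card_le_classCount_stagePerm st hσ
  have h2 := card_le_two_mul_classCount_edgeFlip next hα
  have h3 := genus_nonneg _ _ hσ hα
  rw [defect, sum_stageTurn next r st hα]
  have h2' : (S.card : ℝ) ≤ 2 * classCount (SameCycle.setoid (edgeFlip next)) S := by
    exact_mod_cast h2
  have h3' : (classCount (SameCycle.setoid (stagePerm st)) S : ℝ) +
      classCount (SameCycle.setoid (edgeFlip next)) S +
      classCount (SameCycle.setoid (stagePerm st * edgeFlip next)) S ≤
      S.card + 2 * classCount (components (stagePerm st) (edgeFlip next)) S := by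
    exact_mod_cast h3
  linarith

theorem stagePerm_update_oriented {st : Fin n → Option Smoothing} {v : Fin n} (hv : st v = none) :
    stagePerm (Function.update st v (some .oriented)) =
      stagePerm st * swap (.outgoing (v, .left)) (.incoming (v, .right)) := by
  ext h
  rw [mul_apply]
  rcases h with ⟨w, _ | _⟩ | ⟨w, _ | _⟩ <;> by_cases hw : w = v <;>
    simp [stagePerm, swap_apply_def, hw, hv]

theorem stagePerm_update_disoriented {st : Fin n → Option Smoothing} {v : Fin n}
    (hv : st v = none) :
    stagePerm (Function.update st v (some .disoriented)) =
      stagePerm st * swap (.incoming (v, .left)) (.outgoing (v, .right)) := by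
  ext h
  rw [mul_apply]
  rcases h with ⟨w, _ | _⟩ | ⟨w, _ | _⟩ <;> by_cases hw : w = v <;>
    simp [stagePerm, swap_apply_def, hw, hv]

theorem PlanarTurning.update_oriented {next : Perm (Port n)} {r : Port n → ℝ}
    {st : Fin n → Option Smoothing} {v : Fin n} (hv : st v = none)
    (h : PlanarTurning (stagePerm st) (edgeFlip next) (stageTurn next r st)) :
    PlanarTurning (stagePerm (Function.update st v (some .oriented))) (edgeFlip next)
      (stageTurn next r (Function.update st v (some .oriented))) := by
  have hg := defect_stage_le next r (Function.update st v (some .oriented))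
  rw [stagePerm_update_oriented hv] at hg ⊢
  refine h.mul_swap (by simp) ⟨2, ?_⟩ (fun x hxa hxb => ?_) ?_ hg
  · rw [zpow_ofNat, pow_two, mul_apply]
    simp [stagePerm, hv]
  · rw [edgeFlip_symm] at hxa hxb
    have hxa' : edgeFlip next x ≠ .outgoing (v, .left) :=
      fun h => hxa (by rw [← h, edgeFlip_edgeFlip])
    have hxb' : edgeFlip next x ≠ .incoming (v, .right) :=
      fun h => hxb (by rw [← h, edgeFlip_edgeFlip])
    unfold stageTurn
    congr 1
    generalize edgeFlip next x = y at hxa' hxb'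
    rcases y with ⟨w, _ | _⟩ | ⟨w, _ | _⟩ <;> by_cases hw : w = v <;>
      simp_all [stageCorner]
  -- The cusps at the top and at the bottom, of `1 / 2` each, become straight.
  · rw [edgeFlip_symm]
    unfold stageTurn
    rw [edgeFlip_edgeFlip, edgeFlip_edgeFlip]
    simp [stageCorner, hv]
    ring

theorem PlanarTurning.update_disoriented {next : Perm (Port n)} {r : Port n → ℝ}
    {st : Fin n → Option Smoothing} {v : Fin n} (hv : st v = none)
    (h : PlanarTurning (stagePerm st) (edgeFlip next) (stageTurn next r st)) :
    PlanarTurning (stagePerm (Function.update st v (some .disoriented))) (edgeFlip next)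
      (stageTurn next r (Function.update st v (some .disoriented))) := by
  have hg := defect_stage_le next r (Function.update st v (some .disoriented))
  rw [stagePerm_update_disoriented hv] at hg ⊢
  refine h.mul_swap (by simp) ⟨2, ?_⟩ (fun x hxa hxb => ?_) ?_ hg
  · rw [zpow_ofNat, pow_two, mul_apply]
    simp [stagePerm, hv]
  · rw [edgeFlip_symm] at hxa hxb
    have hxa' : edgeFlip next x ≠ .incoming (v, .left) :=
      fun h => hxa (by rw [← h, edgeFlip_edgeFlip])
    have hxb' : edgeFlip next x ≠ .outgoing (v, .right) :=
      fun h => hxb (by rw [← h, edgeFlip_edgeFlip])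
    unfold stageTurn
    congr 1
    generalize edgeFlip next x = y at hxa' hxb'
    rcases y with ⟨w, _ | _⟩ | ⟨w, _ | _⟩ <;> by_cases hw : w = v <;>
      simp_all [stageCorner]
  -- The straight corners on the left and on the right become half turns of `-1 / 2` each.
  · rw [edgeFlip_symm]
    unfold stageTurn
    rw [edgeFlip_edgeFlip, edgeFlip_edgeFlip]
    simp [stageCorner, hv]
    ring

/-- Faces are removed one at a time; a face of turning number 1 contributes 0 to the defect, one of
turning number -1 contributes 2. -/
theorem exists_defect_eq_two_mul {H : Type*} [Fintype H] [DecidableEq H] {φ : Perm H} {τ : H → ℝ}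
    (h : ∀ a, ∑ x ∈ classOf (SameCycle.setoid φ) a, τ x = 1 ∨
      ∑ x ∈ classOf (SameCycle.setoid φ) a, τ x = -1)
    (U : Finset H) (hU : Saturated (SameCycle.setoid φ) U) : ∃ k : ℕ, defect φ τ U = 2 * k := by
  induction hk : U.card using Nat.strong_induction_on generalizing U with
  | _ k ih =>
  subst hk
  rcases U.eq_empty_or_nonempty with rfl | ⟨a, ha⟩
  · exact ⟨0, by simp [defect, classCount]⟩
  · set F := classOf (SameCycle.setoid φ) a
    have hF : Saturated (SameCycle.setoid φ) F := saturated_classOf _ a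
    have hFU : F ⊆ U := fun x hx => hU a x (mem_classOf.1 hx) ha
    have hadd := defect_sdiff_add τ hF hFU
    obtain ⟨l, hl⟩ := ih _ (Finset.card_lt_card (Finset.ssubset_iff_of_subset
      Finset.sdiff_subset |>.2 ⟨a, ha, fun h => (Finset.mem_sdiff.1 h).2 (self_mem_classOf _ a)⟩))
      (U \ F) (hU.sdiff hF) rfl
    have hdef : defect φ τ F = 1 - ∑ x ∈ F, τ x := by
      unfold defect
      rw [classCount_classOf]
      norm_num
    rcases h a with h1 | h1
    · exact ⟨l, by rw [← hadd, hl, hdef, h1]; ring⟩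
    · exact ⟨l + 1, by rw [← hadd, hl, hdef, h1]; push_cast; ring⟩

/-- Sending a crossing to the class of its south-west half-edge is constant on connected components
and hits every class. -/
theorem classCount_components_le_componentCount (next : Perm (Port n)) :
    classCount (components clockwise (edgeFlip next)) Finset.univ ≤ componentCount next := by
  classical
  rw [classCount_univ, componentCount]
  set K := components (clockwise (n := n)) (edgeFlip next) with hK
  have hσ : ∀ x, K x (clockwise x) := fun x => (le_sup_left : SameCycle.setoid clockwise ≤ K)
    (sameCycle_apply_right.2 (SameCycle.refl _ x))
  have hα : ∀ x, K x (edgeFlip next x) := fun x =>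
    (le_sup_right : SameCycle.setoid (edgeFlip next) ≤ K)
      (sameCycle_apply_right.2 (SameCycle.refl _ x))
  have hin : ∀ v s, K (.incoming (v, .left)) (.incoming (v, s)) := by
    rintro v (_ | _)
    · exact K.refl _
    · exact K.symm (hσ (.incoming (v, .right)))
  have hout : ∀ v s, K (.incoming (v, .left)) (.outgoing (v, s)) := by
    have h1 : ∀ v, K (.incoming (v, .left)) (.outgoing (v, .left)) :=
      fun v => hσ (.incoming (v, .left))
    rintro v (_ | _)
    · exact h1 v
    · exact K.trans (h1 v) (hσ (.outgoing (v, .left)))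
  have hadj : ∀ v w s t, next (v, s) = (w, t) →
      K (.incoming (v, .left)) (.incoming (w, .left)) := by
    intro v w s t h
    have := hα (.outgoing (v, s))
    simp only [edgeFlip, coe_fn_mk, h] at this
    exact K.trans (hout v s) (K.trans this (K.symm (hin w t)))
  have hwalk : ∀ v w, (crossingGraph next).Walk v w →
      K (.incoming (v, .left)) (.incoming (w, .left)) := by
    intro v w p
    induction p with
    | nil => exact K.refl _
    | cons h _ ih =>
      refine K.trans ?_ ih
      rw [crossingGraph, SimpleGraph.fromRel_adj] at h
      rcases h.2 with ⟨s, t, h⟩ | ⟨s, t, h⟩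
      · exact hadj _ _ s t h
      · exact K.symm (hadj _ _ s t h)
  let f : (crossingGraph next).ConnectedComponent → Quotient K :=
    SimpleGraph.ConnectedComponent.lift (fun v => Quotient.mk K (.incoming (v, .left)))
      fun v w p _ => Quotient.sound (hwalk v w p)
  refine Nat.card_le_card_of_surjective f fun q => ?_
  induction q using Quotient.inductionOn with
  | _ h =>
    rcases h with ⟨v, s⟩ | ⟨v, s⟩
    · exact ⟨(crossingGraph next).connectedComponentMk v, Quotient.sound (hout v s)⟩
    · exact ⟨(crossingGraph next).connectedComponentMk v, Quotient.sound (hin v s)⟩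

theorem LinkDiagram.le_classCount_facePerm (D : LinkDiagram n) :
    n + 2 * classCount (components clockwise (edgeFlip D.next)) Finset.univ ≤
      classCount (SameCycle.setoid (clockwise * edgeFlip D.next)) Finset.univ := by
  have h := D.planar
  have h' := classCount_components_le_componentCount D.next
  rw [faceCount, ← classCount_univ] at h
  have : facePerm D.next = clockwise * edgeFlip D.next := rfl
  rw [this] at h
  omega

/-- Euler's formula makes the total defect at least twice the number of components, and no union of
components exceeds twice their number, so every single component attains 2. -/
theorem LinkDiagram.TangentialDrawing.planarTurning_none {D : LinkDiagram n}
    (R : D.TangentialDrawing) :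
    PlanarTurning (stagePerm fun _ => none) (edgeFlip D.next)
      (stageTurn D.next R.rot fun _ => none) := by
  constructor
  · refine exists_defect_eq_two_mul fun a => ?_
    have h := R.faceTurn_eq a
    have h' : ∑ x ∈ classOf (SameCycle.setoid
        (stagePerm (fun _ => none) * edgeFlip D.next)) a,
        stageTurn D.next R.rot (fun _ => none) x = faceTurn D.next R.rot a := by
      unfold faceTurn stageTurn
      rw [stagePerm_none, stageCorner_none]
      refine Finset.sum_congr (Finset.ext fun x => ?_) fun _ _ => rfl
      rw [mem_classOf, Finset.mem_filter_univ]
      rfl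
    rwa [h']
  · intro a
    have hle := defect_stage_le D.next R.rot (fun _ => none)
    set K := components (stagePerm fun _ => none) (edgeFlip D.next) with hK
    have hS : Saturated K (classOf K a) := saturated_classOf K a
    have huniv : 2 * (classCount K Finset.univ : ℝ) ≤
        defect (stagePerm (fun _ => none) * edgeFlip D.next)
          (stageTurn D.next R.rot fun _ => none) Finset.univ := by
      have hF := D.le_classCount_facePerm
      rw [← stagePerm_none, ← hK] at hF
      have hF' : (n : ℝ) + 2 * classCount K Finset.univ ≤ classCount (SameCycle.setoid
        (stagePerm (fun _ => none) * edgeFlip D.next)) Finset.univ := by exact_mod_cast hF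
      rw [defect, sum_stageTurn _ _ _ fun _ _ => Finset.mem_univ _, stageCorner_none,
        sum_halfEdge_by_crossing]
      simp only [cornerTurn]
      norm_num
      linarith
    have hadd := defect_sdiff_add (φ := stagePerm (fun _ => none) * edgeFlip D.next)
      (stageTurn D.next R.rot fun _ => none) (hS.mono (cycles_mul_le_components _ _))
      (Finset.subset_univ _)
    have hcount := classCount_sdiff_add hS (Finset.subset_univ _)
    have hcount' : (classCount K (Finset.univ \ classOf K a) : ℝ) + classCount K (classOf K a) =
        classCount K Finset.univ := by exact_mod_cast hcount
    have h1 := hle _ hS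
    have h2 := hle _ ((saturated_univ K).sdiff hS)
    rw [classCount_classOf] at h1 hcount'
    push_cast at h1 hcount'
    linarith

/-- The turning numbers of the faces remain those of a plane drawing when crossings are
smoothed. -/
theorem LinkDiagram.TangentialDrawing.planarTurning {D : LinkDiagram n}
    (R : D.TangentialDrawing) (st : Fin n → Option Smoothing) :
    PlanarTurning (stagePerm st) (edgeFlip D.next) (stageTurn D.next R.rot st) := by
  classical
  suffices h : ∀ A : Finset (Fin n), PlanarTurning
      (stagePerm fun v => if v ∈ A then st v else none) (edgeFlip D.next)
      (stageTurn D.next R.rot fun v => if v ∈ A then st v else none) by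
    simpa using h Finset.univ
  intro A
  induction A using Finset.induction_on with
  | empty => simpa using R.planarTurning_none
  | insert v A hv ih =>
    have hupd : (fun w => if w ∈ insert v A then st w else none) =
        Function.update (fun w => if w ∈ A then st w else none) v (st v) := by
      ext1 w
      by_cases hw : w = v
      · subst hw; simp
      · simp [hw]
    have hnone : (fun w => if w ∈ A then st w else none) v = none := if_neg hv
    rw [hupd]
    generalize (fun w => if w ∈ A then st w else none) = g at ih hnone
    rcases hst : st v with _ | _ | _
    · rwa [← hnone, Function.update_eq_self]
    · exact ih.update_oriented hnone
    · exact ih.update_disoriented hnone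

end Smoothing

/-! ### Checkerboard colourings -/

section Checkerboard

open Equiv Perm

/-- The quantity `x.2 + f x.1` is invariant under `π'` and takes both values above every cycle of
`π`. -/
theorem two_mul_classCount_le_of_lift {H : Type*} [Fintype H] {π : Perm H}
    {π' : Perm (H × ZMod 2)} (f : H → ZMod 2) (h1 : ∀ x, (π' x).1 = π x.1)
    (h2 : ∀ x, (π' x).2 + f (π x.1) = x.2 + f x.1) :
    2 * classCount (SameCycle.setoid π) Finset.univ ≤
      classCount (SameCycle.setoid π') Finset.univ := by
  rw [classCount_univ, classCount_univ]
  let g : H × ZMod 2 → Quotient (SameCycle.setoid π) × ZMod 2 :=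
    fun x => (Quotient.mk _ x.1, x.2 + f x.1)
  have hle : SameCycle.setoid π' ≤ Setoid.ker g := by
    rw [cycles_le_iff]
    intro x
    rw [Setoid.ker_def]
    simp only [g, h1, h2]
    congr 1
    exact Quotient.sound (sameCycle_apply_right.2 (SameCycle.refl π x.1))
  let g' : Quotient (SameCycle.setoid π') → Quotient (SameCycle.setoid π) × ZMod 2 :=
    Quotient.lift g fun x y h => hle h
  have hsurj : Function.Surjective g' := by
    rintro ⟨q, i⟩
    induction q using Quotient.inductionOn with
    | _ x => exact ⟨Quotient.mk _ (x, i - f x), by simp [g', g]⟩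
  have := Nat.card_le_card_of_surjective g' hsurj
  rw [Nat.card_prod, Nat.card_zmod] at this
  omega

/-- The double cover of `H` on which `π` acts through the cocycle `x`. -/
def coverPerm {H : Type*} (π : Perm H) (x : H → ZMod 2) : Perm (H × ZMod 2) where
  toFun y := (π y.1, y.2 + x y.1)
  invFun y := (π.symm y.1, y.2 - x (π.symm y.1))
  left_inv y := by simp
  right_inv y := by simp

/-- Above a component of the base lie at most two components of the cover, exchanged by the deck
transformation if there are two. If the count is attained everywhere, the sheets can be labelled
consistently, and `β a` is the label of the sheet through `(a, 0)`. -/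
theorem exists_coboundary_of_classCount_le {H : Type*} [Fintype H] {σ α : Perm H}
    {x y : H → ZMod 2}
    (h : 2 * classCount (components σ α) Finset.univ ≤
      classCount (components (coverPerm σ x) (coverPerm α y)) Finset.univ) :
    ∃ β : H → ZMod 2, (∀ a, β a = β (σ a) + x a) ∧ ∀ a, β a = β (α a) + y a := by
  classical
  rw [classCount_univ, classCount_univ] at h
  set K := components σ α with hK
  set L := components (coverPerm σ x) (coverPerm α y) with hL
  have hLσ : ∀ a i, L (a, i) (σ a, i + x a) := fun a i =>
    (le_sup_left : SameCycle.setoid (coverPerm σ x) ≤ L)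
      (sameCycle_apply_right.2 (SameCycle.refl (coverPerm σ x) (a, i)))
  have hLα : ∀ a i, L (a, i) (α a, i + y a) := fun a i =>
    (le_sup_right : SameCycle.setoid (coverPerm α y) ≤ L)
      (sameCycle_apply_right.2 (SameCycle.refl (coverPerm α y) (a, i)))
  have hdeck : ∀ j a b, L a b → L (a.1, a.2 + j) (b.1, b.2 + j) := by
    intro j
    have : L ≤ L.comap fun a => (a.1, a.2 + j) := by
      refine sup_le (cycles_le_iff.2 fun a => ?_) (cycles_le_iff.2 fun a => ?_)
      · have := hLσ a.1 (a.2 + j)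
        rwa [add_right_comm] at this
      · have := hLα a.1 (a.2 + j)
        rwa [add_right_comm] at this
    exact fun a b hab => this hab
  have hlift : ∀ a b, K a b → ∃ i j, L (a, i) (b, j) := by
    let t : Setoid H :=
      { r := fun a b => ∃ i j, L (a, i) (b, j)
        iseqv := by
          refine ⟨fun a => ⟨0, 0, L.refl _⟩, ?_, ?_⟩
          · rintro a b ⟨i, j, hij⟩
            exact ⟨j, i, L.symm hij⟩
          · rintro a b c ⟨i, j, hij⟩ ⟨k, l, hkl⟩
            refine ⟨i + (k - j), l, L.trans ?_ hkl⟩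
            have := hdeck (k - j) _ _ hij
            simpa using this }
    have : K ≤ t := sup_le (cycles_le_iff.2 fun a => ⟨0, _, hLσ a 0⟩)
      (cycles_le_iff.2 fun a => ⟨0, _, hLα a 0⟩)
    exact fun a b hab => this hab
  let s : Quotient K × ZMod 2 → Quotient L := fun q => Quotient.mk L (q.1.out, q.2)
  have hsurj : Function.Surjective s := by
    intro q
    induction q using Quotient.inductionOn with
    | _ a =>
      obtain ⟨i, j, hij⟩ := hlift a.1 (Quotient.mk K a.1).out
        (K.symm (Quotient.mk_out a.1))
      refine ⟨(Quotient.mk K a.1, j + (a.2 - i)), Quotient.sound (L.symm ?_)⟩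
      have := hdeck (a.2 - i) _ _ hij
      simpa using this
  have hbij : Function.Bijective s := by
    refine hsurj.bijective_of_nat_card_le ?_
    rw [Nat.card_prod, Nat.card_zmod]
    omega
  let e := Equiv.ofBijective s hbij
  let β : H → ZMod 2 := fun a => (e.symm (Quotient.mk L (a, 0))).2
  have hβ : ∀ a i, (e.symm (Quotient.mk L (a, i))).2 = β a + i := by
    intro a i
    have h0 : s (e.symm (Quotient.mk L (a, 0))) = Quotient.mk L (a, 0) := e.apply_symm_apply _
    have h1 : s ((e.symm (Quotient.mk L (a, 0))).1, β a + i) = Quotient.mk L (a, i) := by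
      have := hdeck i _ _ (Quotient.eq.1 h0)
      refine Quotient.sound ?_
      simpa [β] using this
    have h2 : e.symm (Quotient.mk L (a, i)) = ((e.symm (Quotient.mk L (a, 0))).1, β a + i) := by
      rw [Equiv.symm_apply_eq]
      exact h1.symm
    rw [h2]
  refine ⟨β, fun a => ?_, fun a => ?_⟩
  · rw [← hβ (σ a) (x a)]
    have := Quotient.sound (s := L) (hLσ a 0)
    rw [zero_add] at this
    rw [← this]
  · rw [← hβ (α a) (y a)]
    have := Quotient.sound (s := L) (hLα a 0)
    rw [zero_add] at this
    rw [← this]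

/-- The sides, as elements of `ZMod 2`. -/
def sideIndex : Side → ZMod 2
  | .left => 0
  | .right => 1

variable {n : ℕ}

/-- The side of a half-edge, as an element of `ZMod 2`. -/
def sideOf : HalfEdge n → ZMod 2
  | .outgoing p => sideIndex p.2
  | .incoming p => sideIndex p.2

/-- The direction of a half-edge, as an element of `ZMod 2`. -/
def directionOf : HalfEdge n → ZMod 2
  | .outgoing _ => 1
  | .incoming _ => 0

theorem le_classCount_clockwise (n : ℕ) :
    n ≤ classCount (SameCycle.setoid (clockwise (n := n))) Finset.univ := by
  have h := half_card_le_classCount_stagePerm (fun _ : Fin n => none) (S := Finset.univ)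
    fun _ _ => Finset.mem_univ _
  rw [stagePerm_none, stageCorner_none, Finset.card_univ, card_halfEdge,
    sum_halfEdge_by_crossing] at h
  simp only [cornerTurn] at h
  norm_num at h
  have : (n : ℝ) ≤ classCount (SameCycle.setoid (clockwise (n := n))) Finset.univ := by linarith
  exact_mod_cast this

/-- A planar diagram has a checkerboard colouring; `β v` is the colour of the regions on the left
and on the right of the crossing `v`. -/
theorem LinkDiagram.exists_checkerboard (D : LinkDiagram n) :
    ∃ β : Fin n → ZMod 2, ∀ p, β p.1 + β (D.next p).1 =
      sideIndex p.2 + sideIndex (D.next p).2 := by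
  have h2 : ∀ z : ZMod 2, z + z = 0 := by decide
  let α := edgeFlip D.next
  -- The region to the left of an edge has the colour of the crossing plus the side of the port, at
  -- either end. So the colours of the two crossings must differ by the sum of the two sides.
  let y : HalfEdge n → ZMod 2 := fun h => sideOf h + sideOf (α h)
  have hσ := two_mul_classCount_le_of_lift (π := clockwise)
    (π' := coverPerm (clockwise (n := n)) 0) 0 (fun x => rfl) (fun x => by simp [coverPerm])
  have hα := two_mul_classCount_le_of_lift (π := α) (π' := coverPerm α y) sideOf (fun x => rfl)
    (fun x => by
      simp only [coverPerm, coe_fn_mk, y]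
      linear_combination h2 (sideOf (α x.1)))
  have hφ := two_mul_classCount_le_of_lift (π := clockwise * α)
    (π' := coverPerm clockwise 0 * coverPerm α y) (fun h => sideOf h + directionOf h)
    (fun x => rfl) (fun x => by
      have hdir : directionOf x.1 = directionOf (α x.1) + 1 := by
        rcases x.1 with p | p <;> simp [α, edgeFlip, directionOf]
        rfl
      have hturn : ∀ k : HalfEdge n,
          sideOf k + sideOf (clockwise k) + directionOf (clockwise k) = directionOf k + 1 := by
        rintro (⟨v, _ | _⟩ | ⟨v, _ | _⟩) <;>
          simp [clockwise, sideOf, directionOf, sideIndex]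
      simp only [coverPerm, mul_apply, coe_fn_mk, y, Pi.zero_apply]
      linear_combination hturn (α x.1) - hdir)
  -- The cover splits over each vertex, edge and face, so with K and K' components in base and
  -- cover, `2n + 4n + 2(n + 2K) ≤ 8n + 2K'`. This gives `2K ≤ K'`, which trivializes the cover.
  have hg := genus_nonneg (coverPerm (clockwise (n := n)) 0) (coverPerm α y) (S := Finset.univ)
    (fun _ _ => Finset.mem_univ _) (fun _ _ => Finset.mem_univ _)
  have hF : n + 2 * classCount (components clockwise α) Finset.univ ≤
      classCount (SameCycle.setoid (clockwise * α)) Finset.univ := D.le_classCount_facePerm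
  have hn := le_classCount_clockwise n
  have he : Finset.univ.card ≤ 2 * classCount (SameCycle.setoid α) Finset.univ :=
    card_le_two_mul_classCount_edgeFlip D.next fun _ _ => Finset.mem_univ _
  rw [Finset.card_univ, card_halfEdge] at he
  rw [Finset.card_univ, Fintype.card_prod, card_halfEdge, ZMod.card] at hg
  obtain ⟨β, h0, h1⟩ := exists_coboundary_of_classCount_le (σ := clockwise) (α := α)
    (x := 0) (y := y) (by omega)
  refine ⟨fun v => β (.incoming (v, .left)), fun p => ?_⟩
  have hin : ∀ v s, β (.incoming (v, s)) = β (.incoming (v, .left)) := by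
    rintro v (_ | _)
    · rfl
    · simpa [clockwise] using h0 (.incoming (v, .right))
  have hout : ∀ v s, β (.outgoing (v, s)) = β (.incoming (v, .left)) := by
    rintro v (_ | _)
    · simpa [clockwise] using (h0 (.incoming (v, .left))).symm
    · rw [← hin v .right]
      simpa [clockwise] using h0 (.outgoing (v, .right))
  have hp := h1 (.outgoing p)
  have e1 : α (.outgoing p) = .incoming (D.next p) := rfl
  simp only [e1, y, sideOf] at hp
  have e2 := hout p.1 p.2
  have e3 := hin (D.next p).1 (D.next p).2
  simp only [Prod.mk.eta] at e2 e3
  rw [e2, e3] at hp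
  linear_combination hp + h2 (β (.incoming ((D.next p).1, .left)))

/-- Summing the checkerboard relation with weights `c` over the edges, the colours cancel at every
crossing because `c` is a cycle mod 2; what remains of the sides is the usage of the right ports. -/
theorem LinkDiagram.sum_right_eq_zero (D : LinkDiagram n) (c : Port n → ZMod 2)
    (hc : ∀ v, c (D.next.symm (v, .left)) + c (D.next.symm (v, .right)) =
      c (v, .left) + c (v, .right)) :
    ∑ v, (c (D.next.symm (v, .right)) + c (v, .right)) = 0 := by
  obtain ⟨β, hβ⟩ := D.exists_checkerboard
  have h2 : ∀ z : ZMod 2, z + z = 0 := by decide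
  have e1 : ∀ f : Port n → ZMod 2, ∑ p, f p * sideIndex p.2 = ∑ v, f (v, .right) := by
    intro f
    rw [Fintype.sum_prod_type]
    simp [sum_side, sideIndex]
  have e2 : ∀ f : Port n → ZMod 2, ∑ p, f p * β p.1 =
      ∑ v, (f (v, .left) + f (v, .right)) * β v := by
    intro f
    rw [Fintype.sum_prod_type]
    simp [sum_side, add_mul]
  have e3 : ∀ g : Port n → ZMod 2, ∑ p, c p * g (D.next p) = ∑ p, c (D.next.symm p) * g p := by
    intro g
    exact Fintype.sum_equiv D.next _ _ fun p => by simp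
  have key : ∑ p, c p * (β p.1 + β (D.next p).1) =
      ∑ p, c p * (sideIndex p.2 + sideIndex (D.next p).2) := by simp only [hβ]
  simp only [mul_add, Finset.sum_add_distrib] at key
  rw [e3 fun p => β p.1, e3 fun p => sideIndex p.2, e1 c, e1 fun p => c (D.next.symm p),
    e2 c, e2 fun p => c (D.next.symm p)] at key
  simp only [hc, h2] at key
  rw [Finset.sum_add_distrib, add_comm]
  exact key.symm

end Checkerboard

/-! ### The permanent of the blown-up diagram as a state sum -/

section Ryser

variable {R : Type*} [CommRing R]

/-- The indicator of `true`. -/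
def boolInd (R : Type*) [CommRing R] (b : Bool) : R := if b then 1 else 0

/-- The sign in Ryser's formula. -/
def boolSign (R : Type*) [CommRing R] (b : Bool) : R := if b then 1 else -1

theorem prod_sum_eq_sum_prod {ι κ : Type*} [Fintype ι] [DecidableEq ι] [Fintype κ]
    (f : ι → κ → R) : ∏ i, ∑ k, f i k = ∑ g : ι → κ, ∏ i, f i (g i) := by
  rw [Finset.prod_univ_sum, Fintype.piFinset_univ]

/-- The sum factors over `y` into `1 - 0 ^ k`, where `k` is the number of preimages of `y`; it
vanishes exactly when `g` misses some `y`. -/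
theorem sum_boolSign_mul_prod_boolInd {X : Type*} [Fintype X] [DecidableEq X] (g : X → X)
    [Decidable (Function.Bijective g)] :
    ∑ s : X → Bool, (∏ y, boolSign R (s y)) * ∏ x, boolInd R (s (g x)) =
      if Function.Bijective g then 1 else 0 := by
  have h : ∀ s : X → Bool, (∏ y, boolSign R (s y)) * ∏ x, boolInd R (s (g x)) =
      ∏ y, (boolSign R (s y) * boolInd R (s y) ^ (Finset.univ.filter fun x => g x = y).card) := by
    intro s
    rw [Finset.prod_mul_distrib,
      ← Finset.prod_fiberwise Finset.univ g fun x => boolInd R (s (g x))]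
    congr 1
    refine Finset.prod_congr rfl fun y _ => ?_
    rw [← Finset.prod_const]
    refine Finset.prod_congr rfl fun x hx => ?_
    rw [(Finset.mem_filter.1 hx).2]
  simp only [h]
  rw [← prod_sum_eq_sum_prod (fun y b => boolSign R b *
    boolInd R b ^ (Finset.univ.filter fun x => g x = y).card)]
  simp only [Fintype.sum_bool, boolSign, boolInd]
  by_cases hg : Function.Bijective g
  · rw [if_pos hg]
    refine Finset.prod_eq_one fun y _ => ?_
    have : (Finset.univ.filter fun x => g x = y).card ≠ 0 := by
      obtain ⟨x, hx⟩ := hg.2 y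
      exact Finset.card_ne_zero_of_mem (Finset.mem_filter.2 ⟨Finset.mem_univ x, hx⟩)
    simp [this]
  · rw [if_neg hg]
    have hs : ¬ Function.Surjective g := fun hs => hg (Finite.surjective_iff_bijective.1 hs)
    simp only [Function.Surjective, not_forall, not_exists] at hs
    obtain ⟨y, hy⟩ := hs
    refine Finset.prod_eq_zero (Finset.mem_univ y) ?_
    have : (Finset.univ.filter fun x => g x = y) = ∅ := by
      simp [hy]
    rw [this]
    simp

/-- Ryser's formula for the permanent. -/
theorem permanent_eq_ryser {X : Type*} [Fintype X] [DecidableEq X] (N : Matrix X X R) :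
    N.permanent = ∑ s : X → Bool, (∏ y, boolSign R (s y)) *
      ∏ x, ∑ y, N x y * boolInd R (s y) := by
  classical
  simp only [prod_sum_eq_sum_prod, Finset.mul_sum]
  rw [Finset.sum_comm]
  have h : ∀ g : X → X, ∑ s : X → Bool, (∏ y, boolSign R (s y)) *
      ∏ x, N x (g x) * boolInd R (s (g x)) =
      if Function.Bijective g then ∏ x, N x (g x) else 0 := by
    intro g
    simp only [Finset.prod_mul_distrib]
    rw [← mul_boole, ← sum_boolSign_mul_prod_boolInd g, Finset.mul_sum]
    exact Finset.sum_congr rfl fun s _ => by ring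
  simp only [h]
  rw [← Matrix.permanent_transpose, Matrix.permanent]
  refine Fintype.sum_of_injective (fun π : Equiv.Perm X => (π : X → X)) DFunLike.coe_injective
    _ _ (fun g hg => if_neg fun hb => hg ⟨Equiv.ofBijective g hb, rfl⟩) fun π => ?_
  rw [if_pos π.bijective]
  rfl

theorem sum_pi_fin_succ {M κ : Type*} [AddCommMonoid M] [Fintype κ] {k : ℕ}
    (f : (Fin (k + 1) → κ) → M) : ∑ s, f s = ∑ b, ∑ s : Fin k → κ, f (Matrix.vecCons b s) := by
  rw [← Fintype.sum_prod_type' (f := fun b s => f (Matrix.vecCons b s))]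
  exact (Fintype.sum_equiv (Fin.consEquiv fun _ => κ) _ _ fun x => rfl).symm

/-- The contribution of a gadget to the state sum: `i₀`, `i₁` tell whether the edges that end at
the vertices `0`, `1` are used, and `o₄`, `o₆` whether those that start at `4`, `6` are. -/
def gadgetWeight (G : Matrix (Fin 7) (Fin 7) R) (i₀ i₁ o₄ o₆ : Bool) : R :=
  ∑ s : Fin 7 → Bool, (∏ j, boolSign R (s j)) *
    ((∏ k ∈ {0, 1, 2, 3, 5}, ∑ j, G k j * boolInd R (s j)) *
      ((if o₄ then 1 else ∑ j, G 4 j * boolInd R (s j)) *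
        (if o₆ then 1 else ∑ j, G 6 j * boolInd R (s j))) *
      ((if i₀ then boolInd R (s 0) else 1) * (if i₁ then boolInd R (s 1) else 1)))

theorem gadget_row_sum (a b c d e : R) (f : Fin 7 → R) (k : Fin 7) :
    ∑ j, gadget a b c d e k j * f j =
      ![f 1 + f 2 + e * f 5, c * f 0 + f 2 + b * f 3, d * f 0 + a * f 3 + f 5, f 4, f 5, f 6,
        f 3] k := by
  fin_cases k <;> simp [gadget, Fin.sum_univ_seven]

theorem gadgetWeight_gadget (a b c d e : R) (i₀ i₁ o₄ o₆ : Bool) :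
    gadgetWeight (gadget a b c d e) i₀ i₁ o₄ o₆ =
      ∑ s₀, ∑ s₁, ∑ s₂, ∑ s₃, ∑ s₅, boolSign R s₀ * boolSign R s₁ * boolSign R s₂ *
        boolSign R s₃ * boolSign R s₅ *
        ((boolInd R s₁ + boolInd R s₂ + e * boolInd R s₅) *
          (c * boolInd R s₀ + boolInd R s₂ + b * boolInd R s₃) *
          (d * boolInd R s₀ + a * boolInd R s₃ + boolInd R s₅) *
        ((if o₄ then 1 else boolInd R s₅) * (if o₆ then 1 else boolInd R s₃)) *
        ((if i₀ then boolInd R s₀ else 1) * (if i₁ then boolInd R s₁ else 1))) := by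
  have h : ∀ s : Fin 7 → Bool, ∏ k ∈ {0, 1, 2, 3, 5}, ∑ j, gadget a b c d e k j * boolInd R (s j) =
      (boolInd R (s 1) + boolInd R (s 2) + e * boolInd R (s 5)) *
      (c * boolInd R (s 0) + boolInd R (s 2) + b * boolInd R (s 3)) *
      (d * boolInd R (s 0) + a * boolInd R (s 3) + boolInd R (s 5)) *
      boolInd R (s 4) * boolInd R (s 6) := by
    intro s
    simp only [gadget_row_sum a b c d e fun j => boolInd R (s j)]
    rw [Finset.prod_insert (by decide), Finset.prod_insert (by decide),
      Finset.prod_insert (by decide), Finset.prod_pair (by decide)]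
    simp only [Matrix.cons_val]
    ring
  have h4 : ∀ s : Fin 7 → Bool, ∑ j, gadget a b c d e 4 j * boolInd R (s j) = boolInd R (s 5) :=
    fun s => gadget_row_sum a b c d e (fun j => boolInd R (s j)) 4
  have h6 : ∀ s : Fin 7 → Bool, ∑ j, gadget a b c d e 6 j * boolInd R (s j) = boolInd R (s 3) :=
    fun s => gadget_row_sum a b c d e (fun j => boolInd R (s j)) 6
  unfold gadgetWeight
  simp only [h, h4, h6, sum_pi_fin_succ, Fin.prod_univ_seven, Matrix.cons_val,
    Fintype.sum_unique]
  refine Finset.sum_congr rfl fun s₀ _ => Finset.sum_congr rfl fun s₁ _ =>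
    Finset.sum_congr rfl fun s₂ _ => Finset.sum_congr rfl fun s₃ _ => ?_
  rw [Finset.sum_comm]
  refine Finset.sum_congr rfl fun s₅ _ => ?_
  -- Rows 3 and 5 are never removed and force `s 4` and `s 6` to be `true`.
  simp only [Fintype.sum_bool (α := R)]
  simp only [show boolInd R true = 1 from rfl, show boolInd R false = 0 from rfl,
    show boolSign R true = 1 from rfl]
  ring

theorem gadgetWeight_none (a b c d e : R) :
    gadgetWeight (gadget a b c d e) false false false false = d := by
  rw [gadgetWeight_gadget]
  simp [boolInd, boolSign]
  ring

theorem gadgetWeight_all (a b c d e : R) :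
    gadgetWeight (gadget a b c d e) true true true true = b + e * a := by
  rw [gadgetWeight_gadget]
  simp [boolInd, boolSign]
  ring

theorem gadgetWeight_zero_four (a b c d e : R) :
    gadgetWeight (gadget a b c d e) true false true false = 1 := by
  rw [gadgetWeight_gadget]
  simp [boolInd, boolSign]
  ring

theorem gadgetWeight_one_four (a b c d e : R) :
    gadgetWeight (gadget a b c d e) false true true false = c + e * d := by
  rw [gadgetWeight_gadget]
  simp [boolInd, boolSign]
  ring

theorem gadgetWeight_zero_six (a b c d e : R) :
    gadgetWeight (gadget a b c d e) true false false true = a := by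
  rw [gadgetWeight_gadget]
  simp [boolInd, boolSign]
  ring

theorem gadgetWeight_one_six (a b c d e : R) :
    gadgetWeight (gadget a b c d e) false true false true = a * c + b * d := by
  rw [gadgetWeight_gadget]
  simp [boolInd, boolSign]
  ring

/-- The Ryser sum counts surjections onto the seven columns, and fewer than seven factors are left.
With more edges in than out there are more than seven, so no such vanishing is available. -/
theorem gadgetWeight_eq_zero (a b c d e : R) {i₀ i₁ o₄ o₆ : Bool}
    (h : i₀.toNat + i₁.toNat < o₄.toNat + o₆.toNat) :
    gadgetWeight (gadget a b c d e) i₀ i₁ o₄ o₆ = 0 := by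
  rw [gadgetWeight_gadget]
  revert h
  cases i₀ <;> cases i₁ <;> cases o₄ <;> cases o₆ <;> intro h <;>
    first
    | (exfalso; revert h; decide)
    | (simp [boolInd, boolSign]; try ring)

end Ryser

/-! ### The permanent as a sum over sets of diagram edges -/

section StateSum

variable {n : ℕ}

/-- The contribution of a crossing to the state sum of the permanent, by the usage of its incoming
and outgoing edges. -/
noncomputable def crossingWeight (t : CrossingSign) (i o : Side → Bool) : RealLaurent :=
  match t with
  | .positive => gadgetWeight (crossingGadget t) (i .right) (i .left) (o .left) (o .right)
  | .negative => gadgetWeight (crossingGadget t) (i .left) (i .right) (o .right) (o .left)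

theorem crossingWeight_eq (t : CrossingSign) (i o : Side → Bool) :
    crossingWeight t i o = ∑ s : Fin 7 → Bool, (∏ j, boolSign RealLaurent (s j)) *
      ((∏ k ∈ {0, 1, 2, 3, 5}, ∑ j, crossingGadget t k j * boolInd RealLaurent (s j)) *
        (∏ u, if o u then 1 else
          ∑ j, crossingGadget t (exitVertex t u) j * boolInd RealLaurent (s j)) *
        ∏ u, if i u then boolInd RealLaurent (s (entryVertex t u)) else 1) := by
  cases t
  · simp only [crossingWeight, gadgetWeight, prod_side, exitVertex, entryVertex]
    refine Finset.sum_congr rfl fun s _ => ?_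
    ring
  · simp only [crossingWeight, gadgetWeight, prod_side, exitVertex, entryVertex]
    refine Finset.sum_congr rfl fun s _ => ?_
    ring

theorem prod_rows (t : CrossingSign) (β : Fin 7 → RealLaurent) (u : Side → RealLaurent) :
    ∏ k, (β k + ∑ s, if k = exitVertex t s then u s else 0) =
      (∏ k ∈ {0, 1, 2, 3, 5}, β k) * ∏ s, (β (exitVertex t s) + u s) := by
  have h : ∀ f : Fin 7 → RealLaurent, ∏ k ∈ {0, 1, 2, 3, 5}, f k = f 0 * f 1 * f 2 * f 3 * f 5 := by
    intro f
    rw [Finset.prod_insert (by decide), Finset.prod_insert (by decide),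
      Finset.prod_insert (by decide), Finset.prod_pair (by decide)]
    ring
  rw [h]
  cases t
  · simp only [Fin.prod_univ_seven, sum_side, prod_side, exitVertex]
    simp
    ring
  · simp only [Fin.prod_univ_seven, sum_side, prod_side, exitVertex]
    simp
    ring

theorem prod_port {M : Type*} [CommMonoid M] (f : Port n → M) :
    ∏ p, f p = ∏ v, ∏ t, f (v, t) := Fintype.prod_prod_type f

variable {D : LinkDiagram n} (R : D.TangentialDrawing)

theorem LinkDiagram.TangentialDrawing.adjacency_row_sum (x : Fin n × Fin 7)
    (f : Fin n × Fin 7 → RealLaurent) :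
    ∑ y, R.adjacency x y * f y =
      ∑ j, crossingGadget (D.sign x.1) x.2 j * f (x.1, j) +
        ∑ t, if x.2 = exitVertex (D.sign x.1) t then qpow (-2 * R.rot (x.1, t)) *
          f ((D.next (x.1, t)).1, entryVertex (D.sign (D.next (x.1, t)).1) (D.next (x.1, t)).2)
          else 0 := by
  classical
  obtain ⟨v, k⟩ := x
  simp only [LinkDiagram.TangentialDrawing.adjacency, add_mul, Finset.sum_add_distrib]
  congr 1
  · rw [Fintype.sum_prod_type, Finset.sum_eq_single v]
    · simp
    · intro w _ hw
      simp [hw.symm]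
    · simp
  · simp only [Finset.sum_mul]
    rw [Finset.sum_comm, Fintype.sum_prod_type, Finset.sum_eq_single v]
    · refine Finset.sum_congr rfl fun t _ => ?_
      by_cases hk : k = exitVertex (D.sign v) t
      · simp [hk]
      · simp [hk]
    · intro w _ hw
      refine Finset.sum_eq_zero fun t _ => Finset.sum_eq_zero fun y _ => ?_
      simp [hw.symm]
    · simp

/-- The permanent as a sum over the sets of edges of the diagram that a cycle cover may use. -/
theorem LinkDiagram.TangentialDrawing.permanent_adjacency :
    R.adjacency.permanent = ∑ ε : Port n → Bool,
      (∏ p, if ε p then qpow (-2 * R.rot p) else 1) *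
        ∏ v, crossingWeight (D.sign v) (fun t => ε (D.next.symm (v, t))) fun t => ε (v, t) := by
  classical
  have hrow : ∀ s : Fin n × Fin 7 → Bool,
      ∏ x, ∑ y, R.adjacency x y * boolInd RealLaurent (s y) =
      ∑ ε : Port n → Bool, (∏ p, if ε p then qpow (-2 * R.rot p) else 1) *
        ∏ v, ((∏ k ∈ {0, 1, 2, 3, 5}, ∑ j, crossingGadget (D.sign v) k j *
            boolInd RealLaurent (s (v, j))) *
          (∏ t, if ε (v, t) then 1 else ∑ j, crossingGadget (D.sign v)
            (exitVertex (D.sign v) t) j * boolInd RealLaurent (s (v, j))) *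
          ∏ t, if ε (D.next.symm (v, t)) then
            boolInd RealLaurent (s (v, entryVertex (D.sign v) t)) else 1) := by
    intro s
    let β : Fin n → Fin 7 → RealLaurent := fun v k =>
      ∑ j, crossingGadget (D.sign v) k j * boolInd RealLaurent (s (v, j))
    let χ : Port n → RealLaurent := fun p =>
      boolInd RealLaurent (s (p.1, entryVertex (D.sign p.1) p.2))
    -- Only the exit rows contain diagram edges, one each; `b` tells whether that edge or the gadget
    -- part of the row is taken.
    have h1 : ∏ x, ∑ y, R.adjacency x y * boolInd RealLaurent (s y) =
        (∏ v, ∏ k ∈ {0, 1, 2, 3, 5}, β v k) *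
          ∏ p : Port n, ∑ b : Bool, if b then qpow (-2 * R.rot p) * χ (D.next p)
            else β p.1 (exitVertex (D.sign p.1) p.2) := by
      rw [Fintype.prod_prod_type, prod_port, ← Finset.prod_mul_distrib]
      refine Finset.prod_congr rfl fun v _ => ?_
      simp only [R.adjacency_row_sum (_, _) fun y => boolInd RealLaurent (s y)]
      rw [prod_rows (D.sign v) (fun k => β v k)
        fun t => qpow (-2 * R.rot (v, t)) * χ (D.next (v, t))]
      simp only [Fintype.sum_bool, if_true, Bool.false_eq_true, if_false, add_comm]
    rw [h1, prod_sum_eq_sum_prod, Finset.mul_sum]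
    refine Finset.sum_congr rfl fun ε _ => ?_
    have h2 : (∏ p : Port n, if ε p then qpow (-2 * R.rot p) * χ (D.next p)
        else β p.1 (exitVertex (D.sign p.1) p.2)) =
        (∏ p, if ε p then qpow (-2 * R.rot p) else 1) *
        ((∏ p : Port n, if ε p then 1 else β p.1 (exitVertex (D.sign p.1) p.2)) *
          ∏ p, if ε (D.next.symm p) then χ p else 1) := by
      have h3 : (∏ p, if ε (D.next.symm p) then χ p else 1) =
          ∏ p, if ε p then χ (D.next p) else 1 :=
        (Fintype.prod_equiv D.next _ _ fun p => by simp).symm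
      rw [h3, ← Finset.prod_mul_distrib, ← Finset.prod_mul_distrib]
      refine Finset.prod_congr rfl fun p _ => ?_
      cases ε p <;> simp
    rw [h2, prod_port (fun p => if ε p then 1 else β p.1 (exitVertex (D.sign p.1) p.2)),
      prod_port (fun p => if ε (D.next.symm p) then χ p else 1), ← Finset.prod_mul_distrib,
      mul_left_comm, ← Finset.prod_mul_distrib]
    simp only [β, χ, mul_assoc]
  rw [permanent_eq_ryser]
  simp only [hrow, Finset.mul_sum]
  rw [Finset.sum_comm]
  refine Finset.sum_congr rfl fun ε _ => ?_
  simp only [crossingWeight_eq]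
  rw [prod_sum_eq_sum_prod, Finset.mul_sum]
  refine Fintype.sum_equiv (Equiv.curry _ _ _) _ _ fun s => ?_
  rw [mul_left_comm]
  congr 1
  rw [Fintype.prod_prod_type, ← Finset.prod_mul_distrib]
  rfl

end StateSum

/-! ### The state sum of a smoothed diagram -/

section Loops

open Equiv Perm

theorem qpow_add (x y : ℝ) : qpow (x + y) = qpow x * qpow y := by
  simp [qpow, AddMonoidAlgebra.single_mul_single]

theorem qpow_zero : qpow 0 = 1 := rfl

theorem prod_qpow {ι : Type*} (S : Finset ι) (f : ι → ℝ) :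
    ∏ i ∈ S, qpow (f i) = qpow (∑ i ∈ S, f i) := by
  classical
  induction S using Finset.induction_on with
  | empty => simp [qpow_zero]
  | insert a S ha ih => rw [Finset.prod_insert ha, Finset.sum_insert ha, ih, qpow_add]

variable {n : ℕ}

/-- Whether a choice of used edges is compatible with a smoothing of a crossing. -/
def Compatible (t : Smoothing) (i o : Side → Bool) : Prop :=
  match t with
  | .oriented => i .left = o .left ∧ i .right = o .right
  | .disoriented => i .right = !i .left ∧ o .right = !o .left

open Classical in
/-- The contribution of a smoothed crossing, by the usage of its incoming and outgoing edges. -/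
noncomputable def smoothingWeight (t : Smoothing) (i o : Side → Bool) : RealLaurent :=
  if Compatible t i o then
    match t with
    | .oriented => 1
    | .disoriented => qpow ((if i .left then 1 / 2 else -1 / 2) + (if o .left then 1 / 2 else -1 / 2))
  else 0

/-- The half-edges from which edges are traversed when the used edges are reversed. -/
def traversed (next : Perm (Port n)) (ε : Port n → Bool) : HalfEdge n → Bool
  | .outgoing p => !ε p
  | .incoming p => ε (next.symm p)

theorem traversed_edgeFlip (next : Perm (Port n)) (ε : Port n → Bool) (h : HalfEdge n) :
    traversed next ε (edgeFlip next h) = !traversed next ε h := by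
  cases h <;> simp [traversed, edgeFlip]

/-- The rotation around the vertices when every crossing is smoothed. -/
abbrev smoothPerm (s : Fin n → Smoothing) : Perm (HalfEdge n) := stagePerm fun v => some (s v)

theorem smoothPerm_smoothPerm (s : Fin n → Smoothing) (h : HalfEdge n) :
    smoothPerm s (smoothPerm s h) = h := by
  rcases h with ⟨v, _ | _⟩ | ⟨v, _ | _⟩ <;> rcases hv : s v with _ | _ <;> simp [stagePerm, hv]

theorem stageCorner_smoothPerm (s : Fin n → Smoothing) (h : HalfEdge n) :
    stageCorner (fun v => some (s v)) (smoothPerm s h) =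
      -stageCorner (fun v => some (s v)) h := by
  rcases h with ⟨v, _ | _⟩ | ⟨v, _ | _⟩ <;> rcases hv : s v with _ | _ <;>
    simp [stagePerm, stageCorner, hv] <;> norm_num

/-- At a smoothed crossing a directed loop arrives by one of two joined half-edges and departs by
the other. -/
theorem compatible_iff (next : Perm (Port n)) (s : Fin n → Smoothing) (ε : Port n → Bool) :
    (∀ v, Compatible (s v) (fun t => ε (next.symm (v, t))) fun t => ε (v, t)) ↔
      ∀ h, traversed next ε (smoothPerm s h) = !traversed next ε h := by
  constructor
  · intro hc h
    have key : ∀ v, s v = .oriented ∨ s v = .disoriented := fun v => by cases s v <;> simp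
    rcases h with ⟨v, _ | _⟩ | ⟨v, _ | _⟩ <;> have hv := hc v <;> rcases key v with hs | hs <;>
      rw [hs] at hv <;> simp only [Compatible] at hv <;> simp [stagePerm, traversed, hs, hv]
  · intro hc v
    have h1 := hc (.incoming (v, .left))
    have h2 := hc (.incoming (v, .right))
    have h3 := hc (.outgoing (v, .left))
    rcases hs : s v with _ | _
    · simp only [stagePerm, traversed, hs, coe_fn_mk] at h1 h2
      exact ⟨(Bool.not_inj h1).symm, (Bool.not_inj h2).symm⟩
    · simp only [stagePerm, traversed, hs, coe_fn_mk] at h1 h3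
      exact ⟨h1, Bool.not_inj h3⟩

theorem mk_edgeOf_smoothPerm (next : Perm (Port n)) (s : Fin n → Smoothing) (h : HalfEdge n) :
    Quot.mk (JoinedBySmoothing next s) (edgeOf next (smoothPerm s h)) =
      Quot.mk (JoinedBySmoothing next s) (edgeOf next h) := by
  have hor : ∀ v t, s v = .oriented →
      Quot.mk (JoinedBySmoothing next s) (next.symm (v, t)) =
        Quot.mk (JoinedBySmoothing next s) (v, t) :=
    fun v t hv => Quot.sound ⟨v, by rw [hv]; exact ⟨t, by simp⟩⟩
  have hin : ∀ v, s v = .disoriented →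
      Quot.mk (JoinedBySmoothing next s) (next.symm (v, .left)) =
        Quot.mk (JoinedBySmoothing next s) (next.symm (v, .right)) :=
    fun v hv => Quot.sound ⟨v, by rw [hv]; exact Or.inl (by simp)⟩
  have hout : ∀ v, s v = .disoriented →
      Quot.mk (JoinedBySmoothing next s) (v, .left) =
        Quot.mk (JoinedBySmoothing next s) (v, .right) :=
    fun v hv => Quot.sound ⟨v, by rw [hv]; exact Or.inr ⟨rfl, rfl⟩⟩
  rcases h with ⟨v, _ | _⟩ | ⟨v, _ | _⟩ <;> rcases hv : s v with _ | _ <;>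
    simp [stagePerm, edgeOf, hv, hor, hin, hout]

theorem JoinedBySmoothing.exists_halfEdge {next : Perm (Port n)} {s : Fin n → Smoothing}
    {e f : Port n} (h : JoinedBySmoothing next s e f) :
    ∃ k, edgeOf next k = e ∧ edgeOf next (smoothPerm s k) = f := by
  obtain ⟨v, hv⟩ := h
  rcases hs : s v with _ | _
  · rw [hs] at hv
    obtain ⟨t, h1, h2⟩ := hv
    refine ⟨.incoming (v, t), ?_, ?_⟩
    · rw [← h1]; simp [edgeOf]
    · cases t <;> simp [stagePerm, hs, edgeOf, h2]
  · rw [hs] at hv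
    rcases hv with ⟨h1, h2⟩ | ⟨h1, h2⟩
    · refine ⟨.incoming (v, .left), ?_, ?_⟩
      · rw [← h1]; simp [edgeOf]
      · simp [stagePerm, hs, edgeOf, ← h2]
    · refine ⟨.outgoing (v, .left), h1.symm, ?_⟩
      simp [stagePerm, hs, edgeOf, h2]

/-- Both factors are involutions, so conjugation by the flip inverts the face permutation: the two
sides of a loop are its two directions. -/
theorem sameCycle_edgeFlip {next : Perm (Port n)} {s : Fin n → Smoothing} {x y : HalfEdge n}
    (h : SameCycle (smoothPerm s * edgeFlip next) x y) :
    SameCycle (smoothPerm s * edgeFlip next) (edgeFlip next x) (edgeFlip next y) := by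
  have := h.conj (g := edgeFlip next)
  have hinv : edgeFlip next * (smoothPerm s * edgeFlip next) * (edgeFlip next)⁻¹ =
      (smoothPerm s * edgeFlip next)⁻¹ := by
    rw [eq_inv_iff_mul_eq_one]
    ext z
    simp [mul_apply, smoothPerm_smoothPerm, edgeFlip_edgeFlip]
  rwa [hinv, sameCycle_inv] at this

theorem sameCycle_or_of_mk_eq {next : Perm (Port n)} {s : Fin n → Smoothing} {x y : HalfEdge n}
    (h : Quot.mk (JoinedBySmoothing next s) (edgeOf next x) =
      Quot.mk (JoinedBySmoothing next s) (edgeOf next y)) :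
    SameCycle (smoothPerm s * edgeFlip next) x y ∨
      SameCycle (smoothPerm s * edgeFlip next) (edgeFlip next x) y := by
  let t : Setoid (HalfEdge n) :=
    { r := fun x y => SameCycle (smoothPerm s * edgeFlip next) x y ∨
        SameCycle (smoothPerm s * edgeFlip next) (edgeFlip next x) y
      iseqv := by
        refine ⟨fun x => Or.inl (SameCycle.refl _ x), ?_, ?_⟩
        · rintro x y (h | h)
          · exact Or.inl h.symm
          · have := sameCycle_edgeFlip h.symm
            rw [edgeFlip_edgeFlip] at this
            exact Or.inr this
        · rintro x y z (h | h) (h' | h')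
          · exact Or.inl (h.trans h')
          · exact Or.inr ((sameCycle_edgeFlip h).trans h')
          · exact Or.inr (h.trans h')
          · have := sameCycle_edgeFlip h
            rw [edgeFlip_edgeFlip] at this
            exact Or.inl (this.trans h') }
  have hα : ∀ x, t x (edgeFlip next x) := fun x => Or.inr (SameCycle.refl _ _)
  have hσ : ∀ x, t x (smoothPerm s x) := fun x => by
    refine Or.inr ⟨1, ?_⟩
    rw [zpow_one, mul_apply, edgeFlip_edgeFlip]
  have hout : ∀ x, t x (.outgoing (edgeOf next x)) := by
    intro x
    cases x with
    | outgoing p => exact t.refl _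
    | incoming p => exact hα (.incoming p)
  let f : Quot (JoinedBySmoothing next s) → Quotient t :=
    Quot.lift (fun p => Quotient.mk t (.outgoing p)) fun e f hef => by
      obtain ⟨k, rfl, rfl⟩ := hef.exists_halfEdge
      exact Quotient.sound (t.trans (t.symm (hout k)) (t.trans (hσ k) (hout _)))
  exact t.trans (hout x) (t.trans (Quotient.eq.1 (congrArg f h)) (t.symm (hout y)))

/-- The turning number of the face on the left of a half-edge, when all crossings are smoothed. -/
noncomputable def loopTurn (next : Perm (Port n)) (r : Port n → ℝ) (s : Fin n → Smoothing)
    (h : HalfEdge n) : ℝ :=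
  ∑ x ∈ classOf (SameCycle.setoid (smoothPerm s * edgeFlip next)) h,
    stageTurn next r (fun v => some (s v)) x

theorem loopTurn_congr {next : Perm (Port n)} (r : Port n → ℝ) {s : Fin n → Smoothing}
    {x y : HalfEdge n} (h : SameCycle (smoothPerm s * edgeFlip next) x y) :
    loopTurn next r s x = loopTurn next r s y := by
  unfold loopTurn
  congr 1
  ext z
  rw [mem_classOf, mem_classOf]
  exact ⟨fun h' => h.symm.trans h', fun h' => h.trans h'⟩

/-- Reversing a loop changes the sign of the rotation of each edge and of each corner. -/
theorem loopTurn_edgeFlip (next : Perm (Port n)) (r : Port n → ℝ) (s : Fin n → Smoothing)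
    (h : HalfEdge n) : loopTurn next r s (edgeFlip next h) = -loopTurn next r s h := by
  set F := classOf (SameCycle.setoid (smoothPerm s * edgeFlip next)) h with hF
  set κ := stageCorner fun v => some (s v) with hκ
  have h1 : loopTurn next r s (edgeFlip next h) =
      ∑ x ∈ F, stageTurn next r (fun v => some (s v)) (edgeFlip next x) := by
    unfold loopTurn
    symm
    refine Finset.sum_equiv (edgeFlip next) (fun x => ?_) fun x _ => rfl
    rw [hF, mem_classOf, mem_classOf]
    refine ⟨fun hx => sameCycle_edgeFlip hx, fun hx => ?_⟩
    have := sameCycle_edgeFlip hx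
    rwa [edgeFlip_edgeFlip, edgeFlip_edgeFlip] at this
  have h2 : ∑ x ∈ F, κ ((smoothPerm s * edgeFlip next) x) = ∑ x ∈ F, κ x :=
    sum_comp_perm_of_mem (saturated_cycles_iff.1 (saturated_classOf _ h)) κ
  have h3 : ∀ x, κ (edgeFlip next x) = -κ ((smoothPerm s * edgeFlip next) x) := by
    intro x
    rw [mul_apply, hκ, stageCorner_smoothPerm, neg_neg]
  rw [h1, loopTurn, ← hF]
  simp only [stageTurn, edgeFlip_edgeFlip, edgeTurn_edgeFlip, Finset.sum_add_distrib,
    Finset.sum_neg_distrib, ← hκ, h3, h2]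
  ring

variable {D : LinkDiagram n} (R : D.TangentialDrawing)

theorem smoothingWeight_eq_qpow (next : Perm (Port n)) {s : Fin n → Smoothing} {ε : Port n → Bool}
    (v : Fin n)
    (hv : Compatible (s v) (fun t => ε (next.symm (v, t))) fun t => ε (v, t)) :
    smoothingWeight (s v) (fun t => ε (next.symm (v, t))) (fun t => ε (v, t)) =
      qpow (∑ k ∈ {.outgoing (v, .left), .outgoing (v, .right), .incoming (v, .left),
        .incoming (v, .right)}, if traversed next ε k then 0
          else stageCorner (fun v => some (s v)) k) := by
  unfold smoothingWeight
  rw [if_pos hv, Finset.sum_insert (by simp), Finset.sum_insert (by simp),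
    Finset.sum_pair (by simp)]
  rcases hs : s v with _ | _
  · simp [stageCorner, hs, qpow_zero]
  · rw [hs] at hv
    obtain ⟨h1, h2⟩ := hv
    beta_reduce at h1 h2
    cases hi : ε (next.symm (v, .left)) <;> cases ho : ε (v, .left) <;> rw [hi] at h1 <;>
      rw [ho] at h2 <;> simp [traversed, stageCorner, hs, h1, h2, hi, ho] <;> norm_num

/-- Corners are counted where a directed loop arrives; the flip attaches each of them to the
half-edge from which that edge was entered, matching `stageTurn`. -/
theorem prod_smoothingWeight_mul (next : Perm (Port n)) (r : Port n → ℝ) {s : Fin n → Smoothing}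
    {ε : Port n → Bool}
    (hε : ∀ v, Compatible (s v) (fun t => ε (next.symm (v, t))) fun t => ε (v, t)) :
    (∏ v, smoothingWeight (s v) (fun t => ε (next.symm (v, t))) fun t => ε (v, t)) *
      ∏ p, qpow (if ε p then -r p else r p) =
      qpow (∑ h, if traversed next ε h then stageTurn next r (fun v => some (s v)) h else 0) := by
  rw [Finset.prod_congr rfl fun v _ => smoothingWeight_eq_qpow next v (hε v), prod_qpow, prod_qpow,
    ← qpow_add]
  congr 1
  set κ := stageCorner fun v => some (s v) with hκ
  have h1 : ∑ v, ∑ k ∈ {.outgoing (v, .left), .outgoing (v, .right), .incoming (v, .left),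
        .incoming (v, .right)}, (if traversed next ε k then 0 else κ k) =
      ∑ h, if traversed next ε h then κ (edgeFlip next h) else 0 := by
    have h2 : (∑ h, if traversed next ε h then κ (edgeFlip next h) else 0) =
        ∑ h, if traversed next ε h then 0 else κ h := by
      refine Fintype.sum_equiv (edgeFlip next) _ _ fun h => ?_
      rw [traversed_edgeFlip]
      cases traversed next ε h <;> rfl
    rw [h2, sum_halfEdge_by_crossing]
    refine Finset.sum_congr rfl fun v _ => ?_
    rw [Finset.sum_insert (by simp), Finset.sum_insert (by simp), Finset.sum_pair (by simp)]
    ring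
  have h3 : ∑ p, (if ε p then -r p else r p) =
      ∑ h, if traversed next ε h then edgeTurn next r h else 0 := by
    have h4 : (∑ p, if traversed next ε (.incoming p) then edgeTurn next r (.incoming p) else 0) =
        ∑ p, if ε p then -r p else 0 := Fintype.sum_equiv next.symm _ _ fun p => rfl
    have h5 : (∑ p, if traversed next ε (.outgoing p) then edgeTurn next r (.outgoing p) else 0) =
        ∑ p, if ε p then 0 else r p := by
      refine Finset.sum_congr rfl fun p _ => ?_
      cases hp : ε p <;> simp [traversed, edgeTurn, hp]
    rw [sum_halfEdge, h4, h5, ← Finset.sum_add_distrib]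
    refine Finset.sum_congr rfl fun p _ => ?_
    cases ε p <;> simp
  rw [h1, h3, ← Finset.sum_add_distrib]
  refine Finset.sum_congr rfl fun h _ => ?_
  cases traversed next ε h
  · simp
  · simp [stageTurn, hκ, add_comm]

theorem LinkDiagram.TangentialDrawing.loopTurn_eq (s : Fin n → Smoothing) (h : HalfEdge n) :
    loopTurn D.next R.rot s h = 1 ∨ loopTurn D.next R.rot s h = -1 :=
  (R.planarTurning fun v => some (s v)).sum_class h

open Classical in
/-- Every loop of a smoothed diagram is worth `q + q⁻¹` in the state sum with rotation numbers. -/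
theorem LinkDiagram.TangentialDrawing.sum_smoothingWeight (s : Fin n → Smoothing) :
    ∑ ε : Port n → Bool,
      (∏ v, smoothingWeight (s v) (fun t => ε (D.next.symm (v, t))) fun t => ε (v, t)) *
        ∏ p, qpow (if ε p then -R.rot p else R.rot p) =
      (qpow 1 + qpow (-1)) ^ loopCount D.next s := by
  set J := JoinedBySmoothing D.next s with hJ
  -- `P` selects, for every loop, its counter-clockwise direction.
  let P : HalfEdge n → Bool := fun h => decide (loopTurn D.next R.rot s h = 1)
  have hPα : ∀ h, P (edgeFlip D.next h) = !P h := by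
    intro h
    simp only [P, loopTurn_edgeFlip]
    rcases R.loopTurn_eq s h with h1 | h1 <;> rw [h1] <;> norm_num
  have hPφ : ∀ x y, SameCycle (smoothPerm s * edgeFlip D.next) x y → P x = P y := by
    intro x y h
    simp only [P, loopTurn_congr R.rot h]
  have hPσ : ∀ h, P (smoothPerm s h) = !P h := by
    intro h
    rw [← hPα]
    refine (hPφ _ _ ⟨1, ?_⟩).symm
    rw [zpow_one, mul_apply, edgeFlip_edgeFlip]
  let L : HalfEdge n → Quot J := fun h => Quot.mk J (edgeOf D.next h)
  have hLα : ∀ h, L (edgeFlip D.next h) = L h := fun h => by simp only [L, edgeOf_edgeFlip]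
  have hLσ : ∀ h, L (smoothPerm s h) = L h := fun h => mk_edgeOf_smoothPerm D.next s h
  have hLφ : ∀ x y, SameCycle (smoothPerm s * edgeFlip D.next) x y → L x = L y := by
    have : SameCycle.setoid (smoothPerm s * edgeFlip D.next) ≤ Setoid.ker L :=
      cycles_le_iff.2 fun x => by
        rw [Setoid.ker_def, mul_apply, hLσ, hLα]
    exact fun x y h => this h
  -- `b` directs each loop, `false` meaning turning number 1 and `true` meaning -1; `E b` is the set
  -- of edges that are then run backwards.
  let E : (Quot J → Bool) → Port n → Bool := fun b p =>
    !(xor (b (Quot.mk J p)) (P (.outgoing p)))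
  have hE : ∀ b h, traversed D.next (E b) h = xor (b (L h)) (P h) := by
    intro b h
    cases h with
    | outgoing p => simp [traversed, E, L, edgeOf]
    | incoming p =>
      have := hPα (.incoming p)
      simp only [edgeFlip, coe_fn_mk] at this
      simp [traversed, E, L, edgeOf, this]
  have hcomp : ∀ b v, Compatible (s v) (fun t => E b (D.next.symm (v, t))) fun t => E b (v, t) := by
    intro b
    rw [compatible_iff]
    intro h
    rw [hE, hE, hLσ, hPσ, Bool.xor_not]
  have : Fintype (Quot J) := Fintype.ofFinite _
  have hcard : loopCount D.next s = Fintype.card (Quot J) := by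
    rw [loopCount, Nat.card_eq_fintype_card]
  rw [hcard, ← Finset.card_univ, ← Finset.prod_const]
  have hbool : qpow 1 + qpow (-1) = ∑ b : Bool, qpow (if b then -1 else 1) := by
    rw [Fintype.sum_bool, add_comm]
    simp
  simp only [hbool]
  rw [prod_sum_eq_sum_prod]
  symm
  refine Fintype.sum_of_injective E ?_ _ _ ?_ ?_
  · intro b b' hbb
    ext q
    induction q using Quot.inductionOn with
    | _ p =>
      have := congrFun hbb p
      simp only [E] at this
      exact Bool.xor_left_inj.1 (Bool.not_inj this)
  · intro ε hε
    have hnot : ¬ ∀ v, Compatible (s v) (fun t => ε (D.next.symm (v, t))) fun t => ε (v, t) := by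
      intro hc
      rw [compatible_iff] at hc
      -- For compatible `ε`, comparing the directions given by `ε` and by `P` yields a function that
      -- is constant on loops, hence a preimage under `E`.
      let g : HalfEdge n → Bool := fun h => xor (traversed D.next ε h) (P h)
      have hgα : ∀ h, g (edgeFlip D.next h) = g h := fun h => by
        simp [g, traversed_edgeFlip, hPα]
      have hgσ : ∀ h, g (smoothPerm s h) = g h := fun h => by
        simp only [g, hc, hPσ]
        simp
      have hgout : ∀ h, g (.outgoing (edgeOf D.next h)) = g h := by
        intro h
        cases h with
        | outgoing p => rfl
        | incoming p => exact hgα (.incoming p)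
      refine hε ⟨Quot.lift (fun p => g (.outgoing p)) fun e f hef => ?_, ?_⟩
      · obtain ⟨k, rfl, rfl⟩ := hef.exists_halfEdge
        rw [hgout, hgout, hgσ]
      · ext p
        simp [E, g, traversed]
    push Not at hnot
    obtain ⟨v, hv⟩ := hnot
    rw [Finset.prod_eq_zero (Finset.mem_univ v) (if_neg hv), zero_mul]
  · intro b
    rw [prod_smoothingWeight_mul D.next R.rot (hcomp b), prod_qpow]
    congr 1
    rw [← Finset.sum_filter, ← Finset.sum_fiberwise (Finset.univ.filter fun h =>
      traversed D.next (E b) h = true) L]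
    refine Finset.sum_congr rfl fun ℓ _ => ?_
    obtain ⟨h₀, hL₀, ht₀⟩ : ∃ h, L h = ℓ ∧ traversed D.next (E b) h = true := by
      induction ℓ using Quot.inductionOn with
      | _ p =>
        by_cases hp : traversed D.next (E b) (.outgoing p) = true
        · exact ⟨.outgoing p, rfl, hp⟩
        · refine ⟨edgeFlip D.next (.outgoing p), hLα _, ?_⟩
          rw [traversed_edgeFlip]
          simpa using hp
    -- A loop carries the cycles of `h₀` and of its flip; only the first consists of traversed
    -- half-edges.
    have hset : ((Finset.univ.filter fun h => traversed D.next (E b) h = true).filter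
        fun h => L h = ℓ) =
        classOf (SameCycle.setoid (smoothPerm s * edgeFlip D.next)) h₀ := by
      ext x
      rw [Finset.mem_filter, Finset.mem_filter_univ, mem_classOf]
      constructor
      · rintro ⟨hx, hxℓ⟩
        rcases sameCycle_or_of_mk_eq (hL₀.trans hxℓ.symm) with h | h
        · exact h
        · exfalso
          have h1 := hPφ _ _ h
          rw [hPα] at h1
          rw [hE, hxℓ, ← h1, Bool.xor_not] at hx
          rw [hE, hL₀] at ht₀
          rw [ht₀] at hx
          exact absurd hx (by simp)
      · intro h
        have h1 := hLφ _ _ h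
        rw [hE, ← h1, ← hPφ _ _ h, ← hE, hL₀]
        exact ⟨ht₀, rfl⟩
    rw [hset]
    change _ = loopTurn D.next R.rot s h₀
    rw [hE, hL₀] at ht₀
    rcases hb : b ℓ with _ | _
    · rw [hb, Bool.false_xor] at ht₀
      simp only [P, decide_eq_true_eq] at ht₀
      rw [ht₀]
      simp
    · rw [hb, Bool.true_xor, Bool.not_eq_true'] at ht₀
      simp only [P, decide_eq_false_iff_not] at ht₀
      rw [(R.loopTurn_eq s h₀).resolve_left ht₀]
      simp

end Loops

/-! ### Comparison of the two state sums -/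

section JonesPermanent

variable {n : ℕ}

theorem toRealLaurent_T (k : ℤ) : toRealLaurent (LaurentPolynomial.T k) = qpow k := by
  exact AddMonoidAlgebra.mapDomain_single

theorem sum_smoothing {M : Type*} [AddCommMonoid M] (f : Smoothing → M) :
    ∑ t, f t = f .oriented + f .disoriented := by
  have : (Finset.univ : Finset Smoothing) = {.oriented, .disoriented} := rfl
  rw [this, Finset.sum_pair (by simp)]

/-- The sign of the usage of an edge on the right of a crossing. -/
noncomputable def usageSign (b : Bool) : RealLaurent := if b then -1 else 1

/-- The numbers of used incoming and outgoing edges agree. -/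
def BalancedUsage (i o : Side → Bool) : Prop :=
  (i .left).toNat + (i .right).toNat = (o .left).toNat + (o .right).toNat

/-- The contribution of a crossing to the writhe. -/
def CrossingSign.toInt : CrossingSign → ℤ
  | .positive => 1
  | .negative => -1

theorem qpow_one_mul : qpow 1 * qpow (-1) = 1 := by
  rw [← qpow_add, add_neg_cancel, qpow_zero]

/-- A finite check, which explains the gadget weights: `b + e * a` and `d` both become q, `c + e *
d` becomes 0 and `a * c + b * d` becomes 1 at a positive crossing, and inversely in q at a negative
one. The signs absorb the minus sign of the disoriented smoothing when a strand changes side. -/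
theorem crossingWeight_expand (t : CrossingSign) {i o : Side → Bool} (h : BalancedUsage i o) :
    qpow (-2 * (t.toInt : ℝ)) * crossingWeight t i o =
      usageSign (i .right) * usageSign (o .right) *
        ∑ s, toRealLaurent (jonesCoeff t s) * smoothingWeight s i o := by
  have hQ := qpow_one_mul
  have hhalf : ((1 / 2 : ℚ) • (1 : RealLaurent)) + (1 / 2 : ℚ) • 1 = 1 := by
    rw [← add_smul]; norm_num
  have hsmul : ∀ (c : ℚ) (x : RealLaurent), c • x = (c • (1 : RealLaurent)) * x := fun c x => by
    rw [smul_mul_assoc, one_mul]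
  have hneg : ((-1 / 2 : ℚ) • (1 : RealLaurent)) = -((1 / 2 : ℚ) • 1) := by
    rw [← neg_smul]; norm_num
  have h2 : qpow 2 = qpow 1 * qpow 1 := by rw [← qpow_add]; norm_num
  have hm2 : qpow (-2) = qpow (-1) * qpow (-1) := by rw [← qpow_add]; norm_num
  have hhh : qpow (1 / 2 + 1 / 2) = qpow 1 := by norm_num
  have hmm : qpow (-1 / 2 + -1 / 2) = qpow (-1) := by norm_num
  have hhm : qpow (1 / 2 + -1 / 2) = 1 := by
    have : (1 / 2 + -1 / 2 : ℝ) = 0 := by norm_num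
    rw [this, qpow_zero]
  have hmh : qpow (-1 / 2 + 1 / 2) = 1 := by
    have : (-1 / 2 + 1 / 2 : ℝ) = 0 := by norm_num
    rw [this, qpow_zero]
  rw [sum_smoothing]
  unfold BalancedUsage at h
  cases t
  · have e : qpow (-2 * ((CrossingSign.positive.toInt : ℤ) : ℝ)) = qpow (-1) * qpow (-1) := by
      rw [← hm2]; norm_num [CrossingSign.toInt]
    rw [e]
    simp only [jonesCoeff, map_neg, toRealLaurent_T, Int.cast_neg, Int.cast_one, Int.cast_ofNat,
      hm2, crossingWeight, crossingGadget, hsmul _ (qpow 1 + qpow (-1)), hsmul _ (qpow 1), hneg]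
    -- Only `c + c = 1` and `q * q⁻¹ = 1` are needed from here on.
    generalize (1 / 2 : ℚ) • (1 : RealLaurent) = c at hhalf
    revert h
    cases hil : i .left <;> cases hir : i .right <;> cases hol : o .left <;>
      cases hor : o .right <;> intro h <;> simp only [Bool.toNat_false, Bool.toNat_true] at h <;>
      first
      | omega
      | (simp only [gadgetWeight_none, gadgetWeight_all, gadgetWeight_zero_four,
          gadgetWeight_one_four, gadgetWeight_zero_six, gadgetWeight_one_six, smoothingWeight,
          Compatible, hil, hir, hol, hor, usageSign, hhh, hmm, hhm, hmh, Bool.not_true,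
          Bool.not_false, Bool.false_eq_true, Bool.true_eq_false, and_self, if_true, if_false]
         generalize qpow 1 = Q at hQ
         generalize qpow (-1) = P at hQ
         grind)
  · have e : qpow (-2 * ((CrossingSign.negative.toInt : ℤ) : ℝ)) = qpow 1 * qpow 1 := by
      rw [← h2]; norm_num [CrossingSign.toInt]
    rw [e]
    simp only [jonesCoeff, map_neg, toRealLaurent_T, Int.cast_one, Int.cast_ofNat, h2,
      crossingWeight, crossingGadget, hsmul _ (qpow 1 + qpow (-1)), hsmul _ (qpow (-1)), hneg]
    generalize (1 / 2 : ℚ) • (1 : RealLaurent) = c at hhalf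
    revert h
    cases hil : i .left <;> cases hir : i .right <;> cases hol : o .left <;>
      cases hor : o .right <;> intro h <;> simp only [Bool.toNat_false, Bool.toNat_true] at h <;>
      first
      | omega
      | (simp only [gadgetWeight_none, gadgetWeight_all, gadgetWeight_zero_four,
          gadgetWeight_one_four, gadgetWeight_zero_six, gadgetWeight_one_six, smoothingWeight,
          Compatible, hil, hir, hol, hor, usageSign, hhh, hmm, hhm, hmh, Bool.not_true,
          Bool.not_false, Bool.false_eq_true, Bool.true_eq_false, and_self, if_true, if_false]
         generalize qpow 1 = Q at hQ
         generalize qpow (-1) = P at hQ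
         grind)

theorem crossingWeight_eq_zero (t : CrossingSign) {i o : Side → Bool}
    (h : (i .left).toNat + (i .right).toNat < (o .left).toNat + (o .right).toNat) :
    crossingWeight t i o = 0 := by
  cases t
  · exact gadgetWeight_eq_zero _ _ _ _ _ (by rwa [add_comm (i .right).toNat])
  · exact gadgetWeight_eq_zero _ _ _ _ _ (by rwa [add_comm (o .right).toNat])

theorem Compatible.balanced {s : Smoothing} {i o : Side → Bool} (h : Compatible s i o) :
    BalancedUsage i o := by
  unfold BalancedUsage
  cases s
  · rw [h.1, h.2]
  · rw [h.1, h.2]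
    cases i .left <;> cases o .left <;> rfl

theorem prod_usageSign (D : LinkDiagram n) {ε : Port n → Bool}
    (h : ∀ v, BalancedUsage (fun t => ε (D.next.symm (v, t))) fun t => ε (v, t)) :
    ∏ v, (usageSign (ε (D.next.symm (v, .right))) * usageSign (ε (v, .right))) = 1 := by
  let c : Port n → ZMod 2 := fun p => (ε p).toNat
  have hsum := D.sum_right_eq_zero c fun v => by
    have := h v
    unfold BalancedUsage at this
    simp only [c]
    exact_mod_cast congrArg (Nat.cast : ℕ → ZMod 2) this
  let χ : ZMod 2 → RealLaurent := fun z => if z = 0 then 1 else -1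
  have hχ : ∀ z w, χ (z + w) = χ z * χ w := by
    intro z w
    have h01 : ∀ z : ZMod 2, z = 0 ∨ z = 1 := by decide
    have h11 : (1 + 1 : ZMod 2) = 0 := by decide
    rcases h01 z with rfl | rfl <;> rcases h01 w with rfl | rfl <;> simp [χ, h11]
  have hsign : ∀ p, usageSign (ε p) = χ (c p) := by
    intro p
    cases hp : ε p <;> simp [usageSign, χ, c, hp]
  have hprod : ∀ (S : Finset (Fin n)) (f : Fin n → ZMod 2), ∏ v ∈ S, χ (f v) = χ (∑ v ∈ S, f v) := by
    intro S f
    induction S using Finset.induction_on with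
    | empty => simp [χ]
    | insert a S ha ih => rw [Finset.prod_insert ha, Finset.sum_insert ha, ih, hχ]
  simp only [hsign, ← hχ]
  rw [hprod, hsum]
  exact if_pos rfl

/-- The local identity fails for unbalanced usage, but each edge goes out once and comes in once. So
an imbalance somewhere forces a crossing with fewer used edges in than out, where the gadget
vanishes, while no smoothing is compatible with an unbalanced crossing. -/
theorem prod_crossingWeight (D : LinkDiagram n) (ε : Port n → Bool) :
    ∏ v, (qpow (-2 * ((D.sign v).toInt : ℝ)) *
        crossingWeight (D.sign v) (fun t => ε (D.next.symm (v, t))) fun t => ε (v, t)) =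
      ∏ v, ∑ s, toRealLaurent (jonesCoeff (D.sign v) s) *
        smoothingWeight s (fun t => ε (D.next.symm (v, t))) fun t => ε (v, t) := by
  by_cases h : ∀ v, BalancedUsage (fun t => ε (D.next.symm (v, t))) fun t => ε (v, t)
  · rw [Finset.prod_congr rfl fun v _ => crossingWeight_expand (D.sign v) (h v),
      Finset.prod_mul_distrib, prod_usageSign D h, one_mul]
  · have htotal : ∑ v, ((ε (D.next.symm (v, .left))).toNat + (ε (D.next.symm (v, .right))).toNat) =
        ∑ v, ((ε (v, .left)).toNat + (ε (v, .right)).toNat) := by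
      have e : ∀ f : Port n → ℕ, ∑ v, (f (v, .left) + f (v, .right)) = ∑ p, f p := by
        intro f
        rw [Fintype.sum_prod_type]
        simp only [sum_side]
      rw [e fun p => (ε (D.next.symm p)).toNat, e fun p => (ε p).toNat]
      exact Fintype.sum_equiv D.next.symm _ _ fun p => rfl
    have hlt : ∃ v, (ε (D.next.symm (v, .left))).toNat + (ε (D.next.symm (v, .right))).toNat <
        (ε (v, .left)).toNat + (ε (v, .right)).toNat := by
      by_contra hno
      push Not at hno
      have := (Finset.sum_eq_sum_iff_of_le fun v _ => hno v).1 htotal.symm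
      exact h fun v => (this v (Finset.mem_univ v)).symm
    obtain ⟨v, hv⟩ := hlt
    rw [not_forall] at h
    obtain ⟨w, hw⟩ := h
    rw [Finset.prod_eq_zero (Finset.mem_univ v), Finset.prod_eq_zero (Finset.mem_univ w)]
    · refine Finset.sum_eq_zero fun s _ => ?_
      unfold smoothingWeight
      rw [if_neg fun hs => hw hs.balanced, mul_zero]
    · rw [crossingWeight_eq_zero _ hv, mul_zero]

theorem LinkDiagram.qpow_writhe (D : LinkDiagram n) :
    qpow (-2 * (D.writhe : ℝ)) = ∏ v, qpow (-2 * ((D.sign v).toInt : ℝ)) := by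
  rw [prod_qpow, ← Finset.mul_sum, LinkDiagram.writhe]
  push_cast
  rfl

theorem LinkDiagram.TangentialDrawing.qpow_linkRot_mul {D : LinkDiagram n}
    (R : D.TangentialDrawing) (ε : Port n → Bool) :
    qpow R.linkRot * ∏ p, (if ε p then qpow (-2 * R.rot p) else 1) =
      ∏ p, qpow (if ε p then -R.rot p else R.rot p) := by
  rw [LinkDiagram.TangentialDrawing.linkRot, ← prod_qpow, ← Finset.prod_mul_distrib]
  refine Finset.prod_congr rfl fun p _ => ?_
  cases ε p
  · simp
  · simp only [if_true, ← qpow_add]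
    congr 1
    ring

end JonesPermanent

theorem theorem1 (n : ℕ) (D : LinkDiagram n) (R : D.TangentialDrawing) :
    toRealLaurent D.jones =
      qpow (-2 * (D.writhe : ℝ)) * qpow R.linkRot * R.adjacency.permanent := by
  have hloop : toRealLaurent (LaurentPolynomial.T 1 + LaurentPolynomial.T (-1)) =
      qpow 1 + qpow (-1) := by
    rw [map_add, toRealLaurent_T, toRealLaurent_T]
    norm_num
  rw [LinkDiagram.jones, kauffmanSum, map_sum, R.permanent_adjacency, Finset.mul_sum]
  have hR : ∀ ε : Port n → Bool, qpow (-2 * (D.writhe : ℝ)) * qpow R.linkRot *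
      ((∏ p, if ε p then qpow (-2 * R.rot p) else 1) *
        ∏ v, crossingWeight (D.sign v) (fun t => ε (D.next.symm (v, t))) fun t => ε (v, t)) =
      ∑ s : Fin n → Smoothing, (∏ v, toRealLaurent (jonesCoeff (D.sign v) (s v))) *
        ((∏ v, smoothingWeight (s v) (fun t => ε (D.next.symm (v, t))) fun t => ε (v, t)) *
          ∏ p, qpow (if ε p then -R.rot p else R.rot p)) := by
    intro ε
    simp only [← mul_assoc, ← Finset.prod_mul_distrib]
    -- For fixed `ε` the sum over all smoothings is a product over crossings, which is compared with
    -- the gadgets.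
    rw [← Finset.sum_mul, ← prod_sum_eq_sum_prod fun v s => toRealLaurent (jonesCoeff (D.sign v) s) *
      smoothingWeight s (fun t => ε (D.next.symm (v, t))) fun t => ε (v, t),
      ← prod_crossingWeight, ← R.qpow_linkRot_mul, Finset.prod_mul_distrib, D.qpow_writhe]
    ring
  simp only [hR]
  rw [Finset.sum_comm]
  refine Finset.sum_congr rfl fun s _ => ?_
  rw [map_mul, map_prod, map_pow, hloop, ← R.sum_smoothingWeight s, Finset.mul_sum]
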